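/- Let $B=\{B(t)\}_{t\in\mathbb R}$ be a two-sided Brownian motion on a probability space. For $f\in L^2(\mathbb R^p)$ let $I_p^B(f)$ denote the $p$-fold multiple Wiener–Itô integral of the symmetrization $\tilde f(x_1,\dots,x_p)=\frac1{p!}\sum_{\sigma\in\mathfrak S(p)}f(x_{\sigma(1)},\dots,x_{\sigma(p)})$ with respect to $B$, with $I_0^B(c)=c$ for constants $c$. Let $n,q\ge 2$ be integers, and let $h_1,\dots,h_n\in L^2(\mathbb R^q)$ be symmetric. Let $A_{n,q}$ be the set of families $\alpha=(\alpha_{ij})_{1\le i<j\le n}$ of nonnegative integers such that $\sum_{1\le i<j\le n}\alpha_{ij}\mathbf 1_{k\in\{i,j\}}\le q$ for every $k=1,\dots,n$. For $\alpha\in A_{n,q}$ put $$|\alpha|=\sum_{1\le i<j\le n}\alpha_{ij},\qquad \beta^0_k=q-\sum_{1\le i<j\le n}\alpha_{ij}\mathbf 1_{k\in\{i,j\}},\qquad \beta_k=\sum_{j=1}^k\beta_j^0,\quad \beta_0=0,$$ so that $\beta_n=nq-2|\alpha|$, and $$C_\alpha=\frac{q!^{\,n}}{\prod_{k=1}^n\beta_k^0!\,\prod_{1\le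 i<j\le n}\alpha_{ij}!}.$$ Let $u^{i,j}=\alpha_{\min(i,j),\max(i,j)}$ for $i\ne j$ and $u^{i,i}=0$, and define the contraction $$\otimes_\alpha(h_1,\dots,h_n)(\xi_1,\dots,\xi_{nq-2|\alpha|})=\int_{\mathbb R^{|\alpha|}}\prod_{k=1}^n h_k\big(s^{k,1}_1,\dots,s^{k,1}_{u^{k,1}},\dots,s^{k,n}_1,\dots,s^{k,n}_{u^{k,n}},\xi_{1+\beta_{k-1}},\dots,\xi_{\beta_k}\big)\prod_{1\le i<j\le n}ds^{i,j}_1\cdots ds^{i,j}_{u^{i,j}},$$ where $s^{j,i}_r=s^{i,j}_r$. Then, for every $\alpha\in A_{n,q}$, the integral defining $\otimes_\alpha(h_1,\dots,h_n)$ converges absolutely for almost every $\xi$ and defines an element of $L^2(\mathbb R^{nq-2|\alpha|})$; all the multiple integrals $I_q^B(h_k)$ and $I^B_{nq-2|\alpha|}(\otimes_\alpha(h_1,\dots,h_n))$ exist, and almost surely $$\prod_{k=1}^n I_q^B(h_k)=\sum_{\alpha\in A_{n,q}}C_\alpha\, I^B_{nq-2|\alpha|}\big(\otimes_\alpha(h_1,\dots,h_n)\big).$$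 -/

import Mathlib

open MeasureTheory ProbabilityTheory Filter Topology

namespace WienerChaos

noncomputable section

/-! ### Two-sided Brownian motion -/

/-- A two-sided Brownian motion: a centered Gaussian process indexed by `ℝ`, with covariance
`E[B s * B t] = (|s| + |t| - |s - t|) / 2` and almost surely continuous paths. -/
structure IsTwoSidedBrownianMotion {Ω : Type*} [MeasurableSpace Ω] (B : ℝ → Ω → ℝ)
    (P : Measure Ω) : Prop where
  gaussian : IsGaussianProcess B P
  centered : ∀ t, ∫ ω, B t ω ∂P = 0
  cov_eq : ∀ s t, cov[B s, B t; P] = (|s| + |t| - |s - t|) / 2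
  continuous_paths : ∀ᵐ ω ∂P, Continuous fun t => B t ω

/-! ### Multiple Wiener-Itô integrals -/

/-- An elementary function on `ℝ^p` vanishing on diagonals, that is, a finite linear combination
of indicators of boxes `∏ i, (lo i, hi i]` whose sides are pairwise disjoint. -/
structure OffDiagStep (p : ℕ) where
  /-- the number of boxes -/
  N : ℕ
  /-- the coefficients -/
  coeff : Fin N → ℝ
  /-- the left end points of the sides -/
  lo : Fin N → Fin p → ℝ
  /-- the right end points of the sides -/
  hi : Fin N → Fin p → ℝ
  lo_le_hi : ∀ r i, lo r i ≤ hi r i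
  disjoint_sides : ∀ r i j, i ≠ j →
    Disjoint (Set.Ioc (lo r i) (hi r i)) (Set.Ioc (lo r j) (hi r j))

/-- The function on `ℝ^p` represented by an off-diagonal elementary function. -/
def OffDiagStep.toFun {p : ℕ} (e : OffDiagStep p) (t : Fin p → ℝ) : ℝ :=
  ∑ r, e.coeff r * ∏ i, (Set.Ioc (e.lo r i) (e.hi r i)).indicator (fun _ => (1 : ℝ)) (t i)

/-- The multiple integral of an elementary function: the indicator of `∏ i, (lo i, hi i]` is sent
to `∏ i, (B (hi i) - B (lo i))`. -/
def OffDiagStep.integral {Ω : Type*} {p : ℕ} (e : OffDiagStep p) (B : ℝ → Ω → ℝ) (ω : Ω) : ℝ :=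
  ∑ r, e.coeff r * ∏ i, (B (e.hi r i) ω - B (e.lo r i) ω)

/-- The symmetrization of a function of `p` real variables. -/
def symmetrization {p : ℕ} (f : (Fin p → ℝ) → ℝ) (t : Fin p → ℝ) : ℝ :=
  (1 / (p.factorial : ℝ)) * ∑ σ : Equiv.Perm (Fin p), f (fun i => t (σ i))

/-- `f ∈ L²_s(ℝ^p)`: square integrable, and symmetric (as an element of `L²`, so
up to null sets). -/
def MemSymL2 {p : ℕ} (f : (Fin p → ℝ) → ℝ) : Prop :=
  MemLp f 2 volume ∧
    ∀ σ : Equiv.Perm (Fin p), (fun t : Fin p → ℝ => f (fun i => t (σ i))) =ᵐ[volume] f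

/-- `F` is the `p`-fold multiple Wiener-Itô integral of `f ∈ L²(ℝ^p)` with respect to `B`: it is
the `L²(P)`-limit of the integrals of off-diagonal elementary functions which converge in
`L²(ℝ^p)` to the symmetrization of `f`. -/
def IsMultipleIntegral {Ω : Type*} [MeasurableSpace Ω] (B : ℝ → Ω → ℝ) (P : Measure Ω) (p : ℕ)
    (f : (Fin p → ℝ) → ℝ) (F : Ω → ℝ) : Prop :=
  MemLp f 2 volume ∧ MemLp F 2 P ∧
    ∃ e : ℕ → OffDiagStep p,
      Tendsto (fun N => eLpNorm (fun t => (e N).toFun t - symmetrization f t) 2 volume)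
        atTop (𝓝 0) ∧
      Tendsto (fun N => eLpNorm (fun ω => (e N).integral B ω - F ω) 2 P) atTop (𝓝 0)

open Classical in
/-- The multiple Wiener-Itô integral `I_p^B(f)` (a version of it). -/
def multipleIntegral {Ω : Type*} [MeasurableSpace Ω] (B : ℝ → Ω → ℝ) (P : Measure Ω) (p : ℕ)
    (f : (Fin p → ℝ) → ℝ) : Ω → ℝ :=
  if h : ∃ F, IsMultipleIntegral B P p f F then h.choose else 0

/-! ### Multi-indices -/

/-- The pairs `(i, j)` with `i < j`. -/
abbrev Pair (n : ℕ) : Type := {e : Fin n × Fin n // e.1 < e.2}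

/-- The multi-indices `α = (α_{ij}, i < j)`. -/
abbrev MultiIndex (n : ℕ) : Type := Pair n → ℕ

/-- `∑_{i<j} α_{ij} 1_{k ∈ {i,j}}`: the number of variables of the `k`-th function which are
contracted. -/
def deg {n : ℕ} (α : MultiIndex n) (k : Fin n) : ℕ :=
  ∑ e : Pair n, if k = e.1.1 ∨ k = e.1.2 then α e else 0

/-- The set `A_{n,q}` of the multi-indices with `deg α k ≤ q` for all `k` (it is finite; see
`mem_A`). -/
def A (n q : ℕ) : Finset (MultiIndex n) :=
  (Fintype.piFinset fun _ => Finset.range (q + 1)).filter fun α => ∀ k, deg α k ≤ q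

theorem mem_A {n q : ℕ} (α : MultiIndex n) : α ∈ A n q ↔ ∀ k, deg α k ≤ q := by
  simp only [A, Finset.mem_filter, Fintype.mem_piFinset, Finset.mem_range, and_iff_right_iff_imp]
  intro h e
  have h1 : α e ≤ deg α e.1.1 := by
    have := Finset.single_le_sum (s := Finset.univ)
      (f := fun e' : Pair n => if e.1.1 = e'.1.1 ∨ e.1.1 = e'.1.2 then α e' else 0)
      (fun _ _ => Nat.zero_le _) (Finset.mem_univ e)
    simpa [deg] using this
  exact Nat.lt_succ_of_le (h1.trans (h _))

/-- `|α|`. -/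
def size {n : ℕ} (α : MultiIndex n) : ℕ := ∑ e, α e

/-- `β⁰_k`, the number of variables of the `k`-th function which are not contracted. -/
def beta0 {n : ℕ} (q : ℕ) (α : MultiIndex n) (k : Fin n) : ℕ := q - deg α k

/-- `m(α) = ∑_k β⁰_k`, which is `n q - 2 |α|`; see `order_eq`. -/
def order {n : ℕ} (q : ℕ) (α : MultiIndex n) : ℕ := ∑ k, beta0 q α k

/-- The constant `C_α`. -/
def C {n : ℕ} (q : ℕ) (α : MultiIndex n) : ℝ :=
  (q.factorial : ℝ) ^ n /
    ((∏ k, ((beta0 q α k).factorial : ℝ)) * ∏ e, ((α e).factorial : ℝ))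

/-- `u^{i,j} = α_{min(i,j), max(i,j)}` for `i ≠ j`, and `u^{i,i} = 0`. -/
def u {n : ℕ} (α : MultiIndex n) (i j : Fin n) : ℕ :=
  if h : i < j then α ⟨(i, j), h⟩ else if h : j < i then α ⟨(j, i), h⟩ else 0

theorem sum_deg {n : ℕ} (α : MultiIndex n) : ∑ k, deg α k = 2 * size α := by
  unfold deg size
  rw [Finset.sum_comm, Finset.mul_sum]
  refine Finset.sum_congr rfl fun e _ => ?_
  rw [← Finset.sum_filter, Finset.sum_const, smul_eq_mul]
  have : (Finset.univ.filter fun k => k = e.1.1 ∨ k = e.1.2) = {e.1.1, e.1.2} := by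
    ext k; simp
  rw [this, Finset.card_pair e.2.ne]

theorem order_add {n q : ℕ} {α : MultiIndex n} (hα : α ∈ A n q) :
    order q α + 2 * size α = n * q := by
  rw [← sum_deg, order, ← Finset.sum_add_distrib]
  simp [beta0, Nat.sub_add_cancel ((mem_A α).1 hα _)]

theorem order_eq {n q : ℕ} {α : MultiIndex n} (hα : α ∈ A n q) :
    order q α = n * q - 2 * size α := by
  have := order_add hα
  omega

theorem sum_u {n : ℕ} (α : MultiIndex n) (k : Fin n) : ∑ j, u α k j = deg α k := by
  have hu : ∀ j, u α k j =
      ∑ e : Pair n, if e.1 = (k, j) ∨ e.1 = (j, k) then α e else 0 := by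
    intro j
    unfold u
    split_ifs with h1 h2
    · rw [Finset.sum_eq_single (⟨(k, j), h1⟩ : Pair n)]
      · simp
      · rintro ⟨e, he⟩ _ hne
        refine if_neg ?_
        rintro (h | h)
        · exact hne (Subtype.ext h)
        · subst h; exact absurd he (not_lt.2 h1.le)
      · simp
    · rw [Finset.sum_eq_single (⟨(j, k), h2⟩ : Pair n)]
      · simp
      · rintro ⟨e, he⟩ _ hne
        refine if_neg ?_
        rintro (h | h)
        · subst h; exact absurd he (not_lt.2 h2.le)
        · exact hne (Subtype.ext h)
      · simp
    · refine (Finset.sum_eq_zero ?_).symm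
      rintro ⟨e, he⟩ _
      refine if_neg ?_
      rintro (h | h) <;> subst h
      · exact h1 he
      · exact h2 he
  simp_rw [hu]
  rw [Finset.sum_comm, deg]
  refine Finset.sum_congr rfl ?_
  rintro ⟨⟨a, b⟩, hab⟩ _
  have hab' : a < b := hab
  by_cases h1 : k = a
  · subst h1
    rw [Finset.sum_eq_single b]
    · simp
    · intro j _ hj
      refine if_neg ?_
      simp only [Prod.mk.injEq]
      rintro (h | h)
      · exact hj h.2.symm
      · exact hab'.ne' h.2
    · simp
  · by_cases h2 : k = b
    · subst h2
      rw [Finset.sum_eq_single a]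
      · simp
      · intro j _ hj
        refine if_neg ?_
        simp only [Prod.mk.injEq]
        rintro (h | h)
        · exact hab'.ne h.1
        · exact hj h.1.symm
      · simp
    · simp only [h1, h2, or_self, if_false]
      refine Finset.sum_eq_zero fun j _ => if_neg ?_
      simp only [Prod.mk.injEq]
      rintro (h | h)
      · exact h1 h.1.symm
      · exact h2 h.2.symm

/-! ### Contractions -/

/-- The index set of the integration variables `s^{i,j}_r`, `i < j`, `1 ≤ r ≤ α_{ij}`; it has
`|α|` elements. -/
abbrev SIndex {n : ℕ} (α : MultiIndex n) : Type := (e : Pair n) × Fin (α e)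

/-- The variable `s^{k,j}_r`, where `s^{k,j} = s^{j,k}`. -/
def sVar {n : ℕ} (α : MultiIndex n) (s : SIndex α → ℝ) (k j : Fin n) (r : Fin (u α k j)) : ℝ :=
  if h : k < j then s ⟨⟨(k, j), h⟩, Fin.cast (by simp [u, h]) r⟩
  else if h' : j < k then s ⟨⟨(j, k), h'⟩, Fin.cast (by simp [u, h, h']) r⟩
  else 0

/-- The argument list of the `k`-th function in the contraction,
`(s^{k,1}_1, …, s^{k,1}_{u^{k,1}}, …, s^{k,n}_1, …, s^{k,n}_{u^{k,n}},
ξ_{1+β_{k-1}}, …, ξ_{β_k})`.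
The equivalence `finSigmaFinEquiv` numbers the entries of a family of consecutive blocks. -/
def slots {n : ℕ} (q : ℕ) (α : MultiIndex n) (s : SIndex α → ℝ) (ξ : Fin (order q α) → ℝ)
    (k : Fin n) (l : Fin q) : ℝ :=
  if h : (l : ℕ) < ∑ j, u α k j then
    sVar α s k (finSigmaFinEquiv.symm ⟨l, h⟩).1 (finSigmaFinEquiv.symm ⟨l, h⟩).2
  else
    ξ (finSigmaFinEquiv (n := beta0 q α) ⟨k, ⟨(l : ℕ) - ∑ j, u α k j, by
      have := l.2
      rw [sum_u] at *
      simp only [beta0]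
      omega⟩⟩)

/-- The integrand in the definition of the contraction. -/
def contractionIntegrand {n q : ℕ} (α : MultiIndex n) (h : Fin n → (Fin q → ℝ) → ℝ)
    (ξ : Fin (order q α) → ℝ) (s : SIndex α → ℝ) : ℝ :=
  ∏ k, h k (slots q α s ξ k)

/-- The contraction `⊗_α(h_1, …, h_n)`. -/
def contraction {n q : ℕ} (α : MultiIndex n) (h : Fin n → (Fin q → ℝ) → ℝ)
    (ξ : Fin (order q α) → ℝ) : ℝ :=
  ∫ s : SIndex α → ℝ, contractionIntegrand α h ξ s

end

end WienerChaos

namespace WienerChaos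

noncomputable section

/-! ### Hermite polynomials through their generating series -/

section Herm

variable {R S : Type*} [CommRing R] [Algebra ℚ R] [CommRing S] [Algebra ℚ S]

/-! For tensor powers of step functions the formula is an identity between Hermite polynomials; the
general case follows because both sides are multilinear and continuous.

Algebra. The multiple integral of the `q`-th tensor power of a step function `φ` is `q!` times the
coefficient of `s ^ q` in `exp (s W(φ) - s² ‖φ‖² / 2)`, where `W(φ)` is the Wiener integral.
Multiplying the exponentials `exp (t k W(φ k) - (t k)² ‖φ k‖² / 2)` gives the joint exponential with
the full quadratic form, times `exp (∑_{i<j} t i t j ⟨φ i, φ j⟩)`. Comparing coefficients of `∏ (t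
k) ^ q` is `prod_herm`: the second exponential produces the powers of inner products indexed by `α`,
the first a Wick product of multidegree `β⁰`. A contraction of tensor powers is the same product of
inner products times a tensor product (`contraction_tensor`), so this is the theorem for tensor
powers (`hasProductFormula_tensor`).

Integrals. `chaosSpan` collects, as pairs, linear combinations of tensor powers together with their
integrals. Polarization puts symmetrized tensor products, and hence off-diagonal elementary
functions, into it. It carries the Itô isometry `E[F²] = p! ‖f‖²`, obtained from the product formula
for two Hermite polynomials. With density of off-diagonal elementary functions, this gives
existence, almost sure uniqueness, linearity and continuity of the multiple integral. The pairs are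
indexed by formal combinations of time points, since `stepInd 0` vanishes while `B 0` need not
vanish at every `ω`.

Passage to the limit. Cauchy-Schwarz, applied to one contracted variable at a time, bounds the `L²`
norm of a contraction by the product of the `L²` norms (`lintegral_contraction_sq_le`), because each
contracted variable occurs in exactly two factors and each free one in exactly one. Both sides of
the formula are therefore continuous in each factor, and the factors are replaced one by one by
arbitrary symmetric functions (`hasProductFormula`). -/

/-- The series `exp (x s)` in the variable `s`. -/
def expSeries (x : R) : PowerSeries R := PowerSeries.rescale x (PowerSeries.exp R)

/-- The series `exp (x s + y s ^ 2)` in the variable `s`. -/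
def hermSeries (x y : R) : PowerSeries R :=
  expSeries x * PowerSeries.expand 2 two_ne_zero (expSeries y)

/-- The coefficient of `s ^ m` in `exp (x s + y s ^ 2)`. For `y = -v / 2`, this is the Hermite
polynomial with variance `v` divided by `m!`. -/
def herm (m : ℕ) (x y : R) : R := PowerSeries.coeff m (hermSeries x y)

theorem coeff_expSeries (x : R) (m : ℕ) :
    PowerSeries.coeff m (expSeries x) = x ^ m * algebraMap ℚ R (1 / m.factorial) := by
  simp [expSeries, PowerSeries.coeff_rescale, PowerSeries.coeff_exp]

theorem expSeries_add (x y : R) : expSeries (x + y) = expSeries x * expSeries y :=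
  (PowerSeries.exp_mul_exp_eq_exp_add x y).symm

theorem expSeries_zero : expSeries (0 : R) = 1 := by
  simp [expSeries, PowerSeries.rescale_zero]

theorem expSeries_sum {ι : Type*} (s : Finset ι) (x : ι → R) :
    expSeries (∑ i ∈ s, x i) = ∏ i ∈ s, expSeries (x i) := by
  classical
  induction s using Finset.induction_on with
  | empty => simp [expSeries_zero]
  | insert a s ha ih => rw [Finset.sum_insert ha, Finset.prod_insert ha, expSeries_add, ih]

theorem hermSeries_add (x y x' y' : R) :
    hermSeries (x + x') (y + y') = hermSeries x y * hermSeries x' y' := by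
  simp only [hermSeries, expSeries_add, map_mul]; ring

theorem hermSeries_zero_left (y : R) :
    hermSeries 0 y = PowerSeries.expand 2 two_ne_zero (expSeries y) := by
  simp [hermSeries, expSeries_zero]

theorem hermSeries_sum {ι : Type*} (s : Finset ι) (x y : ι → R) :
    hermSeries (∑ i ∈ s, x i) (∑ i ∈ s, y i) = ∏ i ∈ s, hermSeries (x i) (y i) := by
  simp only [hermSeries, expSeries_sum, map_prod, Finset.prod_mul_distrib]

theorem herm_eq_sum (m : ℕ) (x y : R) :
    herm m x y = ∑ p ∈ Finset.HasAntidiagonal.antidiagonal m, x ^ p.1 * algebraMap ℚ R (1 / p.1.factorial) *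
      if 2 ∣ p.2 then y ^ (p.2 / 2) * algebraMap ℚ R (1 / (p.2 / 2).factorial) else 0 := by
  simp only [herm, hermSeries, PowerSeries.coeff_mul, coeff_expSeries, PowerSeries.coeff_expand]

/-- Naturality is the reason for working over arbitrary commutative `ℚ`-algebras: evaluation at a
point turns a Hermite polynomial of formal linear and quadratic forms into one of real numbers. -/
theorem map_herm (f : R →+* S) (m : ℕ) (x y : R) : f (herm m x y) = herm m (f x) (f y) := by
  have h : ∀ r : ℚ, f (algebraMap ℚ R r) = algebraMap ℚ S r := fun r => by
    rw [← RingHom.comp_apply, Subsingleton.elim (f.comp (algebraMap ℚ R)) (algebraMap ℚ S)]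
  simp only [herm_eq_sum, map_sum, map_mul, map_pow, h, apply_ite f, map_zero]

theorem herm_zero (x y : R) : herm 0 x y = 1 := by simp [herm_eq_sum]

theorem herm_one (x y : R) : herm 1 x y = x := by
  simp [herm_eq_sum, Finset.Nat.antidiagonal_succ]

theorem herm_mul_sq (m : ℕ) (t x y : R) : herm m (x * t) (y * t ^ 2) = herm m x y * t ^ m := by
  simp only [herm_eq_sum, Finset.sum_mul]
  refine Finset.sum_congr rfl fun p hp => ?_
  rw [Finset.HasAntidiagonal.mem_antidiagonal] at hp
  split_ifs with h
  · obtain ⟨b, hb⟩ := h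
    rw [← hp, hb, Nat.mul_div_cancel_left _ two_pos, mul_pow, mul_pow, pow_add, ← pow_mul]
    ring
  · simp

end Herm

/-! ### Generating polynomials of Wick products and the product of Hermite polynomials. -/

section Wick

open MvPolynomial

variable {ι : Type*} [Fintype ι]

/-- The linear form with coefficients `x`. -/
def linForm (x : ι → ℝ) : MvPolynomial ι ℝ := ∑ k, MvPolynomial.C (x k) * X k

/-- The quadratic form with matrix `-c / 2`. -/
def quadForm (c : ι → ι → ℝ) : MvPolynomial ι ℝ := ∑ k, ∑ l, MvPolynomial.C (-(c k l) / 2) * (X k * X l)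

/-- The part of degree `m` of the generating function of the Wick products of variables `x k`
with covariances `c`. -/
def wickPoly (x : ι → ℝ) (c : ι → ι → ℝ) (m : ℕ) : MvPolynomial ι ℝ :=
  herm m (linForm x) (quadForm c)

theorem eval_wickPoly (x : ι → ℝ) (c : ι → ι → ℝ) (m : ℕ) (t : ι → ℝ) :
    eval t (wickPoly x c m) =
      herm m (∑ k, x k * t k) (∑ k, ∑ l, -(c k l) / 2 * (t k * t l)) := by
  simp [wickPoly, map_herm, linForm, quadForm]

theorem isHomogeneous_linForm (x : ι → ℝ) : (linForm x).IsHomogeneous 1 :=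
  IsHomogeneous.sum _ _ _ fun k _ => by
    simpa using (isHomogeneous_C ι (x k)).mul (isHomogeneous_X ℝ k)

theorem isHomogeneous_quadForm (c : ι → ι → ℝ) : (quadForm c).IsHomogeneous 2 :=
  IsHomogeneous.sum _ _ _ fun k _ => IsHomogeneous.sum _ _ _ fun l _ => by
    simpa using (isHomogeneous_C ι (-(c k l) / 2)).mul
      ((isHomogeneous_X ℝ k).mul (isHomogeneous_X ℝ l))

theorem isHomogeneous_wickPoly (x : ι → ℝ) (c : ι → ι → ℝ) (m : ℕ) :
    (wickPoly x c m).IsHomogeneous m := by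
  rw [wickPoly, herm_eq_sum]
  refine IsHomogeneous.sum _ _ _ fun p hp => ?_
  rw [Finset.HasAntidiagonal.mem_antidiagonal] at hp
  have hC : ∀ r : ℚ, (algebraMap ℚ (MvPolynomial ι ℝ) r).IsHomogeneous 0 := fun r => by
    rw [IsScalarTower.algebraMap_apply ℚ ℝ (MvPolynomial ι ℝ)]
    exact isHomogeneous_C ι _
  rw [← hp]
  refine IsHomogeneous.mul ?_ ?_
  · have := ((isHomogeneous_linForm x).pow p.1).mul (hC (1 / p.1.factorial))
    rwa [one_mul, add_zero] at this
  · split_ifs with h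
    · have := ((isHomogeneous_quadForm c).pow (p.2 / 2)).mul (hC (1 / (p.2 / 2).factorial))
      rwa [add_zero, Nat.mul_div_cancel' h] at this
    · exact isHomogeneous_zero _ _ _

theorem sum_sum_eq_diag_add_pairs {M : Type*} [AddCommMonoid M] {n : ℕ}
    (f : Fin n → Fin n → M) :
    ∑ k, ∑ l, f k l = ∑ k, f k k + ∑ e : Pair n, (f e.1.1 e.1.2 + f e.1.2 e.1.1) := by
  have h1 : ∀ g : Fin n → Fin n → M,
      ∑ e : Pair n, g e.1.1 e.1.2 = ∑ k, ∑ l, if k < l then g k l else 0 := fun g => by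
    rw [← Fintype.sum_prod_type', ← Finset.sum_filter]
    exact (Finset.sum_subtype _ (by simp) (fun p : Fin n × Fin n => g p.1 p.2)).symm
  have h2 : ∑ k, f k k = ∑ k, ∑ l, if k = l then f k l else 0 := by simp
  rw [Finset.sum_add_distrib, h1, h1 fun k l => f l k, h2,
    Finset.sum_comm (f := fun k l => if k < l then f l k else 0)]
  simp only [← Finset.sum_add_distrib]
  refine Finset.sum_congr rfl fun k _ => Finset.sum_congr rfl fun l _ => ?_
  rcases lt_trichotomy k l with h | h | h
  · simp [h, h.ne, h.not_gt]
  · simp [h]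
  · simp [h, h.ne', h.not_gt]

/-- The monomial `∏ (X i * X j) ^ α i j`, as an exponent. -/
def degExp {n : ℕ} (α : MultiIndex n) : Fin n →₀ ℕ := Finsupp.equivFunOnFinite.symm (deg α)

theorem prod_pair_monomial {n : ℕ} (α : MultiIndex n) (c : Pair n → ℝ) :
    ∏ e : Pair n, (MvPolynomial.C (c e) * (X e.1.1 * X e.1.2)) ^ α e *
        algebraMap ℚ (MvPolynomial (Fin n) ℝ) (1 / (α e).factorial) =
      monomial (degExp α) (∏ e, c e ^ α e / (α e).factorial) := by
  have h : ∀ e : Pair n, (MvPolynomial.C (c e) * (X e.1.1 * X e.1.2)) ^ α e *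
        algebraMap ℚ (MvPolynomial (Fin n) ℝ) (1 / (α e).factorial) =
      monomial (α e • (Finsupp.single e.1.1 1 + Finsupp.single e.1.2 1))
        (c e ^ α e / (α e).factorial) := fun e => by
    rw [X, X, monomial_mul, C_mul_monomial, monomial_pow,
      IsScalarTower.algebraMap_apply ℚ ℝ (MvPolynomial (Fin n) ℝ), algebraMap_eq,
      mul_comm, C_mul_monomial]
    simp [div_eq_inv_mul]
  rw [Finset.prod_congr rfl fun e _ => h e, ← monomial_sum_prod]
  suffices hd : ∑ e : Pair n, α e • (Finsupp.single e.1.1 1 + Finsupp.single e.1.2 1) =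
    degExp α by rw [hd]
  ext k
  simp only [degExp, deg, Finsupp.coe_finsetSum, Finset.sum_apply, Finsupp.smul_apply,
    Finsupp.add_apply, smul_eq_mul, Finsupp.equivFunOnFinite_symm_apply_apply]
  refine Finset.sum_congr rfl fun e _ => ?_
  have he := e.2.ne
  by_cases h1 : k = e.1.1
  · subst h1; simp [Finsupp.single_apply, he.symm]
  · by_cases h2 : k = e.1.2
    · subst h2; simp [Finsupp.single_apply, he]
    · simp [Finsupp.single_apply, h1, h2, Ne.symm h1, Ne.symm h2]

/-- The degree in each variable of the Wick product in the term of index `α`. -/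
def beta0Exp {n : ℕ} (q : ℕ) (α : MultiIndex n) : Fin n →₀ ℕ :=
  Finsupp.equivFunOnFinite.symm (beta0 q α)

theorem coeff_prod_expSeries {n : ℕ} (c : Pair n → ℝ) (l : ℕ) :
    PowerSeries.coeff l (∏ e : Pair n, expSeries (MvPolynomial.C (c e) * (X e.1.1 * X e.1.2))) =
      ∑ α ∈ Finset.finsuppAntidiag (Finset.univ : Finset (Pair n)) l,
        (monomial (degExp α) (∏ e, c e ^ α e / (α e).factorial) : MvPolynomial (Fin n) ℝ) := by
  rw [PowerSeries.coeff_prod]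
  refine Finset.sum_congr rfl fun α _ => ?_
  rw [← prod_pair_monomial]
  simp only [coeff_expSeries]

/-- In the exponent, the left side has only the diagonal part of the quadratic form. Each
off-diagonal pair contributes `-c k l / 2` twice to `quadForm`, and the last exponential compensates
exactly for this. -/
theorem prod_hermSeries {n : ℕ} (x : Fin n → ℝ) (c : Fin n → Fin n → ℝ)
    (hc : ∀ k l, c k l = c l k) :
    ∏ k, hermSeries (MvPolynomial.C (x k) * X k) (MvPolynomial.C (-(c k k) / 2) * X k ^ 2) =
      hermSeries (linForm x) (quadForm c) * PowerSeries.expand 2 two_ne_zero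
        (∏ e : Pair n, expSeries (MvPolynomial.C (c e.1.1 e.1.2) * (X e.1.1 * X e.1.2))) := by
  rw [← expSeries_sum, ← hermSeries_zero_left, ← hermSeries_add, ← hermSeries_sum, add_zero,
    quadForm, sum_sum_eq_diag_add_pairs, add_assoc, ← Finset.sum_add_distrib]
  congr 1
  have : ∀ e : Pair n, MvPolynomial.C (-(c e.1.1 e.1.2) / 2) * (X e.1.1 * X e.1.2) +
      MvPolynomial.C (-(c e.1.2 e.1.1) / 2) * (X e.1.2 * X e.1.1) +
      MvPolynomial.C (c e.1.1 e.1.2) * (X e.1.1 * X e.1.2) =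
        (0 : MvPolynomial (Fin n) ℝ) := fun e => by
    rw [hc e.1.2 e.1.1, mul_comm (X e.1.2)]
    simp only [← add_mul, ← MvPolynomial.C_add]
    ring_nf; simp
  simp only [this, Finset.sum_const_zero, add_zero, sq]

/-- By weighted homogeneity the coefficient of `s ^ m` in the `k`-th series is a multiple of `X k ^
m`, so prescribing the degree `q` in every variable selects a single term of the product. -/
theorem coeff_prod_hermSeries {n : ℕ} (q : ℕ) (x : Fin n → ℝ) (y : Fin n → ℝ) :
    coeff (Finsupp.equivFunOnFinite.symm fun _ => q) (PowerSeries.coeff (n * q) (∏ k,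
      hermSeries (MvPolynomial.C (x k) * X k) (MvPolynomial.C (y k) * X k ^ 2))) =
      ∏ k, herm q (x k) (y k) := by
  have h : ∀ k m, PowerSeries.coeff m
      (hermSeries (MvPolynomial.C (x k) * X k) (MvPolynomial.C (y k) * X k ^ 2)) =
      (monomial (Finsupp.single k m) (herm m (x k) (y k)) : MvPolynomial (Fin n) ℝ) :=
    fun k m => by
      change herm m _ _ = _
      rw [herm_mul_sq, ← map_herm, X_pow_eq_monomial, C_mul_monomial, mul_one]
  rw [PowerSeries.coeff_prod, coeff_sum]
  simp only [h, ← monomial_sum_prod, coeff_monomial]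
  have h' : ∀ l : Fin n →₀ ℕ, ∑ k, Finsupp.single k (l k) = l := fun l => by
    simp
  simp only [h']
  rw [Finset.sum_ite_eq', if_pos]
  · simp
  · simp [Finset.mem_finsuppAntidiag]

/-- The product formula for Hermite polynomials. -/
theorem prod_herm {n : ℕ} (q : ℕ) (x : Fin n → ℝ) (c : Fin n → Fin n → ℝ)
    (hc : ∀ k l, c k l = c l k) :
    ∏ k, herm q (x k) (-(c k k) / 2) =
      ∑ α ∈ A n q, (∏ e : Pair n, c e.1.1 e.1.2 ^ α e / (α e).factorial) *
        coeff (beta0Exp q α) (wickPoly x c (order q α)) := by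
  classical
  rw [← coeff_prod_hermSeries, prod_hermSeries x c hc, PowerSeries.coeff_mul, coeff_sum]
  set Q : Fin n →₀ ℕ := Finsupp.equivFunOnFinite.symm fun _ => q with hQ
  -- The monomial of `α` divides `∏ X k ^ q` exactly when `α` is admissible, and the complementary
  -- exponent is `β⁰`: this is where the index set and the number of free variables come from.
  have hle : ∀ α : MultiIndex n, degExp α ≤ Q ↔ α ∈ A n q := fun α => by
    rw [mem_A]; exact Iff.rfl
  have hsub : ∀ α : MultiIndex n, Q - degExp α = beta0Exp q α := fun α => by
    ext k; simp [hQ, degExp, beta0Exp, beta0]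
  -- Each `α` contributes to a single bidegree in `s`, namely `(order q α, 2 * size α)`. Writing
  -- this as an indicator allows the two sums to be exchanged.
  have key : ∀ p ∈ Finset.HasAntidiagonal.antidiagonal (n * q),
      coeff Q (PowerSeries.coeff p.1 (hermSeries (linForm x) (quadForm c)) *
        PowerSeries.coeff p.2 (PowerSeries.expand 2 two_ne_zero (∏ e : Pair n,
          expSeries (MvPolynomial.C (c e.1.1 e.1.2) * (X e.1.1 * X e.1.2))))) =
      ∑ α ∈ A n q, if (order q α, 2 * size α) = p then
        (∏ e : Pair n, c e.1.1 e.1.2 ^ α e / (α e).factorial) *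
        coeff (beta0Exp q α) (wickPoly x c (order q α)) else 0 := by
    rintro ⟨a, b⟩ hp
    rw [Finset.HasAntidiagonal.mem_antidiagonal] at hp
    rw [PowerSeries.coeff_expand]
    split_ifs with hb
    · obtain ⟨l, rfl⟩ := hb
      rw [coeff_prod_expSeries fun e : Pair n => c e.1.1 e.1.2, Nat.mul_div_cancel_left _ two_pos,
        Finset.mul_sum, coeff_sum]
      simp only [coeff_mul_monomial', hle, hsub]
      rw [← Finset.sum_filter, ← Finset.sum_filter]
      refine Finset.sum_bij' (fun α _ => ⇑α) (fun α _ => Finsupp.equivFunOnFinite.symm α)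
        ?_ ?_ ?_ ?_ ?_
      · intro α hα
        rw [Finset.mem_filter, Finset.mem_finsuppAntidiag] at hα
        have := order_add hα.2
        rw [Finset.mem_filter]
        refine ⟨hα.2, ?_⟩
        have hs : size (⇑α) = l := hα.1.1
        rw [hs] at this ⊢
        exact Prod.ext (by simp only; omega) rfl
      · intro α hα
        rw [Finset.mem_filter, Prod.mk.injEq] at hα
        rw [Finset.mem_filter, Finset.mem_finsuppAntidiag]
        refine ⟨⟨?_, by simp⟩, hα.1⟩
        have : size α = l := by omega
        exact this
      · intro α _; ext; rfl
      · intro α _; ext; rfl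
      · intro α hα
        rw [Finset.mem_filter, Finset.mem_finsuppAntidiag] at hα
        have := order_add hα.2
        have hs : size (⇑α) = l := hα.1.1
        have : a = order q (⇑α) := by rw [hs] at this; omega
        subst this
        exact mul_comm _ _
    · rw [mul_zero, coeff_zero]
      refine (Finset.sum_eq_zero fun α _ => if_neg fun h => hb ?_).symm
      exact ⟨size α, (congrArg Prod.snd h).symm⟩
  rw [Finset.sum_congr rfl key, Finset.sum_comm]
  refine Finset.sum_congr rfl fun α hα => ?_
  rw [Finset.sum_ite_eq, if_pos]
  rw [Finset.HasAntidiagonal.mem_antidiagonal]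
  exact order_add hα

end Wick

/-! ### Extraction of coefficients -/

/-- Polarization in abstract form. A coefficient outside `S` would be detected by a linear
functional vanishing on `S`; this functional turns the family into a real polynomial that is zero
everywhere, hence zero. -/
theorem coeff_mem_of_eval_mem {ι M : Type*} [Fintype ι] [AddCommGroup M] [Module ℝ M]
    (S : Submodule ℝ M) (s : Finset (ι →₀ ℕ)) (v : (ι →₀ ℕ) → M)
    (h : ∀ t : ι → ℝ, ∑ β ∈ s, (∏ k, t k ^ β k) • v β ∈ S) : ∀ β ∈ s, v β ∈ S := by
  classical
  intro β hβ
  by_contra hv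
  obtain ⟨φ, hφ, hS⟩ := Submodule.exists_le_ker_of_notMem hv
  have h0 : ∑ γ ∈ s, MvPolynomial.monomial γ (φ (v γ)) = 0 := by
    refine MvPolynomial.funext fun t => ?_
    have := hS (h t)
    rw [LinearMap.mem_ker, map_sum] at this
    simp only [map_smul, smul_eq_mul] at this
    simp only [map_sum, map_zero, MvPolynomial.eval_monomial, Finsupp.prod_fintype _ _
      (fun _ => pow_zero _), mul_comm (φ _)]
    exact this
  have := congrArg (MvPolynomial.coeff β) h0
  simp only [MvPolynomial.coeff_sum, MvPolynomial.coeff_monomial, Finset.sum_ite_eq', hβ,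
    if_true, MvPolynomial.coeff_zero] at this
  exact hφ this

theorem eval_eq_sum_finsuppAntidiag {ι : Type*} [Fintype ι] [DecidableEq ι] {m : ℕ}
    {p : MvPolynomial ι ℝ} (hp : p.IsHomogeneous m) (t : ι → ℝ) :
    MvPolynomial.eval t p = ∑ β ∈ Finset.finsuppAntidiag (Finset.univ : Finset ι) m,
      (∏ k, t k ^ β k) * p.coeff β := by
  rw [MvPolynomial.eval_eq']
  simp only [mul_comm (∏ k, t k ^ _)]
  refine Finset.sum_subset (fun β hβ => ?_) fun β _ hβ => ?_
  · rw [Finset.mem_finsuppAntidiag]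
    refine ⟨?_, by simp⟩
    have := hp (MvPolynomial.mem_support_iff.1 hβ)
    rw [Finsupp.weight_apply, Finsupp.sum_fintype _ _ (by simp)] at this
    simpa using this
  · rw [MvPolynomial.notMem_support_iff.1 hβ, zero_mul]

/-! ### Moments of Gaussian variables -/

section Moments

variable {Ω : Type*} [MeasurableSpace Ω] {P : Measure Ω} {X : Ω → ℝ} {v : NNReal}

theorem interior_integrableExpSet_gaussian (hX : P.map X = gaussianReal 0 v)
    (hm : AEMeasurable X P) : interior (integrableExpSet X P) = Set.univ := by
  have : integrableExpSet X P = Set.univ := by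
    ext t
    simp only [integrableExpSet, Set.mem_ofPred_eq, Set.mem_univ, iff_true]
    have := integrable_exp_mul_gaussianReal (μ := 0) (v := v) t
    rw [← hX] at this
    exact this.comp_aemeasurable hm
  rw [this, interior_univ]

/-- The moment generating function satisfies `M' = v t M`. Differentiating this repeatedly gives a
two-step recursion, which at `t = 0` reads `E[X ^ (n + 2)] = (n + 1) v E[X ^ n]`. -/
theorem integral_pow_gaussian [IsProbabilityMeasure P] (hX : P.map X = gaussianReal 0 v)
    (hm : AEMeasurable X P) (n : ℕ) :
    ∫ ω, X ω ^ n ∂P = if 2 ∣ n then n.factorial * ((v : ℝ) / 2) ^ (n / 2) / (n / 2).factorial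
      else 0 := by
  have hi := interior_integrableExpSet_gaussian hX hm
  set M : ℕ → ℝ → ℝ := fun n t => ∫ ω, X ω ^ n * Real.exp (t * X ω) ∂P with hM
  have hd : ∀ n t, HasDerivAt (M n) (M (n + 1) t) t := fun n t =>
    hasDerivAt_integral_pow_mul_exp_real (by rw [hi]; trivial) n
  have h0 : ∀ t, M 0 t = Real.exp (v * t ^ 2 / 2) := fun t => by
    have := mgf_gaussianReal hX t
    simpa [mgf, hM] using this
  have h1 : ∀ t, M 1 t = v * t * M 0 t := fun t => by
    have : HasDerivAt (M 0) (v * t * Real.exp (v * t ^ 2 / 2)) t := by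
      rw [funext h0]
      convert! (((hasDerivAt_id t).pow 2).const_mul (v : ℝ) |>.div_const 2).exp using 1
      simp; ring
    rw [h0]
    exact (hd 0 t).unique this
  have h2 : ∀ n t, M (n + 2) t = v * t * M (n + 1) t + (n + 1) * v * M n t := by
    intro n
    induction n with
    | zero =>
      intro t
      have : HasDerivAt (M 1) (v * M 0 t + v * t * M 1 t) t := by
        rw [funext h1]
        convert! ((hasDerivAt_id t).const_mul (v : ℝ)).mul (hd 0 t) using 1
        simp only [id, mul_one, zero_add, h1]
      rw [(hd 1 t).unique this]; push_cast; ring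
    | succ n ih =>
      intro t
      have : HasDerivAt (M (n + 2))
          (v * M (n + 1) t + v * t * M (n + 2) t + (n + 1) * v * M (n + 1) t) t := by
        rw [funext ih]
        convert! (((hasDerivAt_id t).const_mul (v : ℝ)).mul (hd (n + 1) t)).add
          ((hd n t).const_mul ((n + 1) * v : ℝ)) using 1
        simp only [id, mul_one, show n + 1 + 1 = n + 2 from rfl, ih]
      rw [(hd (n + 2) t).unique this]; push_cast; ring
  have hz : ∀ n, M n 0 = ∫ ω, X ω ^ n ∂P := fun n => by simp [hM]
  rw [← hz]
  clear_value M
  induction n using Nat.twoStepInduction with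
  | zero => simp [h0]
  | one => simp [h1]
  | more n ih _ =>
    rw [h2, ih]
    have e1 : 2 ∣ n + 2 ↔ 2 ∣ n := by omega
    have e2 : (n + 2) / 2 = n / 2 + 1 := by omega
    simp only [e1, e2]
    split_ifs with h
    · obtain ⟨k, rfl⟩ := h
      rw [Nat.mul_div_cancel_left _ two_pos]
      have hk := Nat.factorial_ne_zero k
      rw [Nat.factorial_succ (2 * k + 1), Nat.factorial_succ (2 * k), Nat.factorial_succ k]
      push_cast
      field_simp
      ring
    · simp

theorem integrable_pow_gaussian (hX : P.map X = gaussianReal 0 v)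
    (hm : AEMeasurable X P) (n : ℕ) : Integrable (fun ω => X ω ^ n) P :=
  integrable_pow_of_mem_interior_integrableExpSet
    (by rw [interior_integrableExpSet_gaussian hX hm]; trivial) n

theorem memLp_herm_gaussian (hX : P.map X = gaussianReal 0 v)
    (hm : AEMeasurable X P) (n : ℕ) (y : ℝ) : MemLp (fun ω => herm n (X ω) y) 2 P := by
  simp only [herm_eq_sum]
  refine memLp_finsetSum _ fun p _ => ?_
  refine MemLp.mul_const (MemLp.mul_const ?_ _) _
  refine (memLp_two_iff_integrable_sq (hm.pow_const _).aestronglyMeasurable).2 ?_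
  simp only [← pow_mul]
  exact integrable_pow_gaussian hX hm _

/-- As formal series in `s`, the expectation of `exp (s X - v s² / 2)` is `exp (v s² / 2) * exp (-v
s² / 2) = 1`, so its positive coefficients vanish. -/
theorem integral_herm_gaussian [IsProbabilityMeasure P] (hX : P.map X = gaussianReal 0 v)
    (hm : AEMeasurable X P) {n : ℕ} (hn : n ≠ 0) :
    ∫ ω, herm n (X ω) (-v / 2) ∂P = 0 := by
  have h0 : PowerSeries.coeff n (hermSeries (0 : ℝ) ((v : ℝ) / 2) * hermSeries 0 (-(v : ℝ) / 2)) = 0 := by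
    rw [← hermSeries_add]
    simp [hermSeries, expSeries_zero, ← add_div, PowerSeries.coeff_one, hn]
  rw [PowerSeries.coeff_mul] at h0
  simp only [herm_eq_sum]
  refine Eq.trans (integral_finsetSum _ fun p _ =>
    ((integrable_pow_gaussian hX hm _).mul_const _).mul_const _) (Eq.trans ?_ h0)
  refine Finset.sum_congr rfl fun p _ => ?_
  rw [integral_mul_const, integral_mul_const, integral_pow_gaussian hX hm,
    hermSeries_zero_left, hermSeries_zero_left, PowerSeries.coeff_expand,
    PowerSeries.coeff_expand, coeff_expSeries, coeff_expSeries]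
  congr 1
  split_ifs
  · have := Nat.factorial_ne_zero p.1
    simp; field_simp
  · simp

end Moments

/-! ### Step functions -/

/-- The signed indicator of the interval between `0` and `a`. -/
def stepInd (a x : ℝ) : ℝ :=
  (Set.Ioc 0 a).indicator (fun _ => 1) x - (Set.Ioc a 0).indicator (fun _ => 1) x

theorem stepInd_sub {a b : ℝ} (hab : a ≤ b) (x : ℝ) :
    stepInd b x - stepInd a x = (Set.Ioc a b).indicator (fun _ => 1) x := by
  simp only [stepInd, Set.indicator_apply, Set.mem_Ioc]
  by_cases h0 : 0 < x <;> by_cases h1 : a < x <;> by_cases h2 : b < x <;>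
    simp [h0, h1, h2, ← not_lt] <;> linarith

theorem memLp_stepInd (a : ℝ) : MemLp (stepInd a) 2 volume := by
  refine MemLp.sub ?_ ?_ <;>
  exact memLp_indicator_const _ measurableSet_Ioc _ (Or.inr (by simp))

/-- Polarization of `∫ (stepInd a - stepInd b)² = |a - b|`. The value is the covariance of `B a` and
`B b`, which makes `stepInd a ↦ B a` an isometry. -/
theorem integral_stepInd_mul (a b : ℝ) :
    ∫ x, stepInd a x * stepInd b x = (|a| + |b| - |a - b|) / 2 := by
  have h : ∀ a b : ℝ, ∫ x, (stepInd a x - stepInd b x) ^ 2 = |a - b| := by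
    have h' : ∀ a b : ℝ, a ≤ b → ∫ x, (stepInd b x - stepInd a x) ^ 2 = b - a := by
      intro a b hab
      have : ∀ x, (stepInd b x - stepInd a x) ^ 2 = (Set.Ioc a b).indicator (fun _ => 1) x :=
        fun x => by rw [stepInd_sub hab]; simp [Set.indicator_apply]
      simp only [this]
      rw [integral_indicator_const _ measurableSet_Ioc]
      simp [Measure.real, hab]
    intro a b
    rcases le_total a b with hab | hab
    · rw [abs_sub_comm, abs_of_nonneg (sub_nonneg.2 hab), ← h' a b hab]
      simp only [sub_sq_comm (stepInd a _)]
    · rw [h' b a hab, abs_of_nonneg (sub_nonneg.2 hab)]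
  have h0 : ∀ a : ℝ, ∫ x, stepInd a x ^ 2 = |a| := fun a => by
    simpa [stepInd] using h a 0
  have hi : ∀ a : ℝ, Integrable (fun x => stepInd a x ^ 2) :=
    fun a => (memLp_stepInd a).integrable_sq
  have hi' : Integrable (fun x => (stepInd a x - stepInd b x) ^ 2) :=
    ((memLp_stepInd a).sub (memLp_stepInd b)).integrable_sq
  rw [← h0 a, ← h0 b, ← h a b, ← integral_add (hi a) (hi b),
    ← integral_sub (f := fun x => stepInd a x ^ 2 + stepInd b x ^ 2) ((hi a).add (hi b)) hi',
    ← integral_div]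
  congr 1; ext x; ring

/-- The step function attached to a finitely supported family of coefficients. -/
def stepFun : (ℝ →₀ ℝ) →ₗ[ℝ] ℝ → ℝ := Finsupp.linearCombination ℝ stepInd

/-- The inner product of two step functions. -/
def stepInner (φ ψ : ℝ →₀ ℝ) : ℝ := ∫ x, stepFun φ x * stepFun ψ x

theorem memLp_stepFun (φ : ℝ →₀ ℝ) : MemLp (stepFun φ) 2 volume := by
  induction φ using Finsupp.induction_linear with
  | zero => rw [map_zero]; exact MemLp.zero
  | add φ ψ hφ hψ => rw [map_add]; exact hφ.add hψ
  | single a c =>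
    rw [stepFun, Finsupp.linearCombination_single]
    exact (memLp_stepInd a).const_smul c

theorem stepInner_comm (φ ψ : ℝ →₀ ℝ) : stepInner φ ψ = stepInner ψ φ := by
  simp only [stepInner, mul_comm]

theorem stepInner_sum_smul_right {ι : Type*} [Fintype ι] (φ : ℝ →₀ ℝ) (t : ι → ℝ)
    (ψ : ι → ℝ →₀ ℝ) : stepInner φ (∑ k, t k • ψ k) = ∑ k, t k * stepInner φ (ψ k) := by
  simp only [stepInner, map_sum, map_smul, Finset.sum_apply, Pi.smul_apply, smul_eq_mul,
    Finset.mul_sum, ← integral_const_mul]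
  rw [integral_finsetSum]
  · simp only [mul_left_comm]
  · intro k _
    simp only [mul_left_comm (stepFun φ _)]
    exact ((memLp_stepFun φ).integrable_mul (memLp_stepFun (ψ k))).const_mul _

theorem stepInner_sum_smul {ι : Type*} [Fintype ι] (t : ι → ℝ) (ψ : ι → ℝ →₀ ℝ) :
    stepInner (∑ k, t k • ψ k) (∑ k, t k • ψ k) =
      ∑ k, ∑ l, stepInner (ψ k) (ψ l) * (t k * t l) := by
  rw [stepInner_sum_smul_right]
  refine Finset.sum_congr rfl fun k _ => ?_
  rw [stepInner_comm, stepInner_sum_smul_right, Finset.mul_sum]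
  refine Finset.sum_congr rfl fun l _ => by ring

theorem stepInner_self_eq_sum (φ : ℝ →₀ ℝ) :
    stepInner φ φ = ∑ a ∈ φ.support, ∑ b ∈ φ.support,
      φ a * φ b * ((|a| + |b| - |a - b|) / 2) := by
  have h : ∀ x, stepFun φ x = ∑ a ∈ φ.support, φ a * stepInd a x := fun x => by
    simp [stepFun, Finsupp.linearCombination_apply, Finsupp.sum, Finset.sum_apply]
  have hi : ∀ a b, Integrable (fun x => φ a * stepInd a x * (φ b * stepInd b x)) := fun a b =>
    ((memLp_stepInd a).const_mul _).integrable_mul ((memLp_stepInd b).const_mul _)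
  simp only [stepInner, h, Finset.sum_mul_sum]
  rw [integral_finsetSum _ fun a _ => integrable_finsetSum _ fun b _ => hi a b]
  refine Finset.sum_congr rfl fun a _ => ?_
  rw [integral_finsetSum _ fun b _ => hi a b]
  refine Finset.sum_congr rfl fun b _ => ?_
  rw [← integral_stepInd_mul, ← integral_const_mul]
  congr 1; ext x; ring

/-! ### Wiener integrals of step functions. -/

section Gaussian

variable {Ω : Type*} [MeasurableSpace Ω] {P : Measure Ω} {B : ℝ → Ω → ℝ}

/-- The Wiener integral of a step function. -/
def wiener (B : ℝ → Ω → ℝ) : (ℝ →₀ ℝ) →ₗ[ℝ] Ω → ℝ := Finsupp.linearCombination ℝ B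

theorem map_wiener [IsProbabilityMeasure P] (hB : IsTwoSidedBrownianMotion B P)
    (φ : ℝ →₀ ℝ) : AEMeasurable (wiener B φ) P ∧
      P.map (wiener B φ) = gaussianReal 0 (stepInner φ φ).toNNReal := by
  have hL : ∀ t, MemLp (B t) 2 P := fun t => (hB.gaussian.hasGaussianLaw_eval t).memLp_two
  have h : wiener B φ = ∑ a ∈ φ.support, φ a • B a := by
    simp [wiener, Finsupp.linearCombination_apply, Finsupp.sum]
  have hG : HasGaussianLaw (wiener B φ) P := by
    rw [h]
    exact (hB.gaussian.smul φ).hasGaussianLaw_sum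
  refine ⟨hG.aemeasurable, ?_⟩
  have h1 : ∫ ω, wiener B φ ω ∂P = 0 := by
    simp only [h, Finset.sum_apply, Pi.smul_apply, smul_eq_mul]
    rw [integral_finsetSum _ fun a _ => ((hL a).integrable one_le_two).const_mul _]
    simp [integral_const_mul, hB.centered]
  have h2 : Var[wiener B φ; P] = stepInner φ φ := by
    rw [← covariance_self hG.aemeasurable, h, covariance_sum_sum'
      (fun a _ => (hL a).const_smul _) (fun a _ => (hL a).const_smul _), stepInner_self_eq_sum]
    simp only [covariance_smul_left, covariance_smul_right, hB.cov_eq]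
    simp only [mul_assoc, mul_left_comm]
  rw [hG.map_eq_gaussianReal, h1, h2]

theorem stepInner_self_nonneg (φ : ℝ →₀ ℝ) : 0 ≤ stepInner φ φ :=
  integral_nonneg fun _ => mul_self_nonneg _

variable [IsProbabilityMeasure P] (hB : IsTwoSidedBrownianMotion B P)
include hB

theorem memLp_herm_wiener (φ : ℝ →₀ ℝ) (n : ℕ) (y : ℝ) :
    MemLp (fun ω => herm n (wiener B φ ω) y) 2 P :=
  memLp_herm_gaussian (map_wiener hB φ).2 (map_wiener hB φ).1 n y

theorem integral_herm_wiener (φ : ℝ →₀ ℝ) {n : ℕ} (hn : n ≠ 0) :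
    ∫ ω, herm n (wiener B φ ω) (-(stepInner φ φ) / 2) ∂P = 0 := by
  have := integral_herm_gaussian (map_wiener hB φ).2 (map_wiener hB φ).1 hn
  rwa [Real.coe_toNNReal _ (stepInner_self_nonneg φ)] at this

end Gaussian

/-! ### The span of the Hermite polynomials of Wiener integrals -/

section Chaos

variable {Ω : Type*} [MeasurableSpace Ω] {P : Measure Ω} {B : ℝ → Ω → ℝ}

/-- The tensor power of a step function, with its multiple integral. -/
def powPair (B : ℝ → Ω → ℝ) (p : ℕ) (φ : ℝ →₀ ℝ) : ((Fin p → ℝ) → ℝ) × (Ω → ℝ) :=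
  (fun x => ∏ i, stepFun φ (x i),
    fun ω => p.factorial * herm p (wiener B φ ω) (-(stepInner φ φ) / 2))

/-- The pairs consisting of a linear combination of tensor powers of step functions and of
its multiple integral. -/
def chaosSpan (B : ℝ → Ω → ℝ) (p : ℕ) : Submodule ℝ (((Fin p → ℝ) → ℝ) × (Ω → ℝ)) :=
  Submodule.span ℝ (Set.range (powPair B p))

/-- The generating polynomial of the tensor products of the `g k`. -/
def tensorPoly {ι : Type*} [Fintype ι] {p : ℕ} (g : ι → ℝ → ℝ) (x : Fin p → ℝ) :
    MvPolynomial ι ℝ := ∏ i, linForm fun k => g k (x i)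

theorem isHomogeneous_tensorPoly {ι : Type*} [Fintype ι] {p : ℕ} (g : ι → ℝ → ℝ)
    (x : Fin p → ℝ) : (tensorPoly g x).IsHomogeneous p := by
  simpa [tensorPoly] using MvPolynomial.IsHomogeneous.prod Finset.univ _ (fun _ => 1)
    fun i _ => isHomogeneous_linForm fun k => g k (x i)

theorem eval_wickPoly_wiener {ι : Type*} [Fintype ι] (φ : ι → ℝ →₀ ℝ) (m : ℕ) (ω : Ω)
    (t : ι → ℝ) :
    MvPolynomial.eval t (wickPoly (fun k => wiener B (φ k) ω)
      (fun k l => stepInner (φ k) (φ l)) m) =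
      herm m (wiener B (∑ k, t k • φ k) ω)
        (-(stepInner (∑ k, t k • φ k) (∑ k, t k • φ k)) / 2) := by
  rw [eval_wickPoly, stepInner_sum_smul]
  congr 1
  · simp [mul_comm]
  · simp only [Finset.sum_div, neg_div, ← Finset.sum_neg_distrib]
    exact Finset.sum_congr rfl fun k _ => Finset.sum_congr rfl fun l _ => by ring

/-- The tensor power of `∑ k, t k • φ k` and its integral are homogeneous polynomials in `t` with
these pairs as coefficients. All their values lie in the span, hence so do the coefficients. -/
theorem coeff_mem_chaosSpan {ι : Type*} [Fintype ι] [DecidableEq ι] {p : ℕ}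
    (φ : ι → ℝ →₀ ℝ) (β : ι →₀ ℕ) (hβ : ∑ k, β k = p) :
    (fun x => (tensorPoly (fun k => stepFun (φ k)) x).coeff β,
      fun ω => p.factorial * (wickPoly (fun k => wiener B (φ k) ω)
        (fun k l => stepInner (φ k) (φ l)) p).coeff β) ∈ chaosSpan B p := by
  refine coeff_mem_of_eval_mem (chaosSpan B p) (Finset.finsuppAntidiag Finset.univ p)
    (fun β => (fun x => (tensorPoly (fun k => stepFun (φ k)) x).coeff β,
      fun ω => p.factorial * (wickPoly (fun k => wiener B (φ k) ω)
        (fun k l => stepInner (φ k) (φ l)) p).coeff β)) (fun t => ?_) β ?_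
  · refine Submodule.subset_span ⟨∑ k, t k • φ k, ?_⟩
    refine Prod.ext ?_ ?_
    · ext x
      simp only [powPair, Prod.fst_sum, Prod.smul_fst, Finset.sum_apply, Pi.smul_apply,
        smul_eq_mul]
      rw [← eval_eq_sum_finsuppAntidiag (isHomogeneous_tensorPoly _ x)]
      simp [tensorPoly, linForm, mul_comm]
    · ext ω
      simp only [powPair, Prod.snd_sum, Prod.smul_snd, Finset.sum_apply, Pi.smul_apply,
        smul_eq_mul, mul_left_comm _ (p.factorial : ℝ), ← Finset.mul_sum]
      rw [← eval_eq_sum_finsuppAntidiag (isHomogeneous_wickPoly _ _ p), eval_wickPoly_wiener]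
  · rw [Finset.mem_finsuppAntidiag]
    exact ⟨hβ, by simp⟩

theorem memLp_tensor {ι : Type*} [Fintype ι] {g : ι → ℝ → ℝ}
    (hg : ∀ i, MemLp (g i) 2 volume) :
    MemLp (fun x : ι → ℝ => ∏ i, g i (x i)) 2 volume := by
  have hm : AEStronglyMeasurable (fun x : ι → ℝ => ∏ i, g i (x i)) volume :=
    Finset.aestronglyMeasurable_fun_prod _ fun i _ =>
      (hg i).1.comp_quasiMeasurePreserving (Measure.quasiMeasurePreserving_eval _ i)
  rw [memLp_two_iff_integrable_sq hm]
  simp only [← Finset.prod_pow]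
  exact Integrable.fintype_prod fun i => (hg i).integrable_sq

theorem memLp_of_mem_chaosSpan [IsProbabilityMeasure P] (hB : IsTwoSidedBrownianMotion B P)
    {p : ℕ} {F : ((Fin p → ℝ) → ℝ) × (Ω → ℝ)} (hF : F ∈ chaosSpan B p) :
    MemLp F.1 2 volume ∧ MemLp F.2 2 P := by
  induction hF using Submodule.span_induction with
  | mem x h =>
    obtain ⟨φ, rfl⟩ := h
    exact ⟨memLp_tensor fun _ => memLp_stepFun φ, (memLp_herm_wiener hB φ p _).const_mul _⟩
  | zero => exact ⟨MemLp.zero, MemLp.zero⟩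
  | add x y _ _ hx hy => exact ⟨hx.1.add hy.1, hx.2.add hy.2⟩
  | smul a x _ hx => exact ⟨hx.1.const_smul a, hx.2.const_smul a⟩

/-- The same extraction of coefficients, in the space of integrable variables of mean zero: the
values of the generating polynomial are centered because they are Hermite polynomials of one
Gaussian variable. Coefficients of the wrong degree are zero. -/
theorem integral_coeff_wickPoly [IsProbabilityMeasure P] (hB : IsTwoSidedBrownianMotion B P)
    {ι : Type*} [Fintype ι] [DecidableEq ι] (φ : ι → ℝ →₀ ℝ) {m : ℕ} (hm : m ≠ 0)
    (β : ι →₀ ℕ) :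
    Integrable (fun ω => (wickPoly (fun k => wiener B (φ k) ω)
      (fun k l => stepInner (φ k) (φ l)) m).coeff β) P ∧
    ∫ ω, (wickPoly (fun k => wiener B (φ k) ω)
      (fun k l => stepInner (φ k) (φ l)) m).coeff β ∂P = 0 := by
  let S : Submodule ℝ (Ω → ℝ) :=
    { carrier := {F | Integrable F P ∧ ∫ ω, F ω ∂P = 0}
      zero_mem' := ⟨integrable_zero _ _ _, by simp⟩
      add_mem' := fun {f g} hf hg => ⟨hf.1.add hg.1, by
        simp only [Pi.add_apply]
        rw [integral_add hf.1 hg.1, hf.2, hg.2, add_zero]⟩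
      smul_mem' := fun c f hf => ⟨hf.1.smul c, by
        simp only [Pi.smul_apply]
        rw [integral_smul, hf.2, smul_zero]⟩ }
  by_cases hβ : ∑ k, β k = m
  · refine coeff_mem_of_eval_mem S (Finset.finsuppAntidiag Finset.univ m)
      (fun β ω => (wickPoly (fun k => wiener B (φ k) ω)
        (fun k l => stepInner (φ k) (φ l)) m).coeff β) (fun t => ?_) β ?_
    · have : ∑ β ∈ Finset.finsuppAntidiag Finset.univ m, (∏ k, t k ^ β k) • (fun ω =>
          (wickPoly (fun k => wiener B (φ k) ω)
            (fun k l => stepInner (φ k) (φ l)) m).coeff β) =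
          fun ω => herm m (wiener B (∑ k, t k • φ k) ω)
            (-(stepInner (∑ k, t k • φ k) (∑ k, t k • φ k)) / 2) := by
        ext ω
        rw [← eval_wickPoly_wiener, eval_eq_sum_finsuppAntidiag (isHomogeneous_wickPoly _ _ m)]
        simp
      rw [this]
      exact ⟨(memLp_herm_wiener hB _ m _).integrable one_le_two, integral_herm_wiener hB _ hm⟩
    · rw [Finset.mem_finsuppAntidiag]
      exact ⟨hβ, by simp⟩
  · have : ∀ ω, (wickPoly (fun k => wiener B (φ k) ω)
        (fun k l => stepInner (φ k) (φ l)) m).coeff β = 0 := fun ω =>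
      (isHomogeneous_wickPoly _ _ m).coeff_eq_zero (by rwa [Finsupp.degree_eq_sum])
    simp [this]

/-- The Hermite polynomials are orthogonal. -/
theorem integral_herm_mul_herm [IsProbabilityMeasure P] (hB : IsTwoSidedBrownianMotion B P)
    (p : ℕ) (φ ψ : ℝ →₀ ℝ) :
    ∫ ω, herm p (wiener B φ ω) (-(stepInner φ φ) / 2) *
      herm p (wiener B ψ ω) (-(stepInner ψ ψ) / 2) ∂P =
      stepInner φ ψ ^ p / p.factorial := by
  have key : ∀ ω, herm p (wiener B φ ω) (-(stepInner φ φ) / 2) *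
      herm p (wiener B ψ ω) (-(stepInner ψ ψ) / 2) =
      ∑ α ∈ A 2 p, (∏ e : Pair 2, stepInner (![φ, ψ] e.1.1) (![φ, ψ] e.1.2) ^ α e /
        (α e).factorial) * (wickPoly (fun k => wiener B (![φ, ψ] k) ω)
          (fun k l => stepInner (![φ, ψ] k) (![φ, ψ] l)) (order p α)).coeff (beta0Exp p α) :=
    fun ω => by
      rw [← prod_herm p (fun k => wiener B (![φ, ψ] k) ω)
        (fun k l => stepInner (![φ, ψ] k) (![φ, ψ] l)) fun k l => stepInner_comm _ _]
      simp [Fin.prod_univ_two]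
  -- With two factors a multi-index is a single number. Wick products of positive order have mean
  -- zero, so only the complete contraction `α = p` survives the expectation.
  let e0 : Pair 2 := ⟨(0, 1), by decide⟩
  have he : ∀ e : Pair 2, e = e0 := by decide
  have hdeg : ∀ (α : MultiIndex 2) k, deg α k = α e0 := fun α k => by
    rw [deg, Fintype.sum_eq_single e0 fun e h => absurd (he e) h]
    fin_cases k <;> simp [e0]
  have hzero : ∀ α ∈ A 2 p, order p α = 0 → α = fun _ => p := fun α hα h => by
    have h1 := (mem_A α).1 hα 0
    have h2 := order_add hα
    ext e
    rw [he e]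
    rw [hdeg] at h1
    have : size α = α e0 := by
      rw [size, Fintype.sum_eq_single e0 fun e h => absurd (he e) h]
    omega
  have hord : order p (fun _ : Pair 2 => p) = 0 := by
    simp [order, beta0, hdeg]
  have hmem : (fun _ : Pair 2 => p) ∈ A 2 p := (mem_A _).2 fun k => by rw [hdeg]
  simp only [key]
  have hint : ∀ α : MultiIndex 2, Integrable (fun ω => (wickPoly (fun k => wiener B (![φ, ψ] k) ω)
      (fun k l => stepInner (![φ, ψ] k) (![φ, ψ] l)) (order p α)).coeff (beta0Exp p α)) P := by
    intro α
    by_cases h : order p α = 0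
    · rw [h]; simp [wickPoly, herm_zero]
    · exact (integral_coeff_wickPoly hB _ h _).1
  rw [integral_finsetSum _ fun α _ => (hint α).const_mul _]
  simp only [integral_const_mul]
  rw [Finset.sum_eq_single_of_mem _ hmem]
  · rw [hord]
    have : beta0Exp p (fun _ : Pair 2 => p) = 0 := by
      ext k; simp [beta0Exp, beta0, hdeg]
    rw [this, Fintype.prod_eq_single e0 fun e h => absurd (he e) h]
    simp [wickPoly, herm_zero, e0]
  · intro α hα hne
    rw [(integral_coeff_wickPoly hB _ (fun h => hne (hzero α hα h)) _).2, mul_zero]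

theorem integral_tensorPow_mul {p : ℕ} (g h : ℝ → ℝ) :
    ∫ x : Fin p → ℝ, (∏ i, g (x i)) * ∏ i, h (x i) = (∫ t, g t * h t) ^ p := by
  simp only [← Finset.prod_mul_distrib]
  rw [volume_pi, integral_fintype_prod_eq_pow (fun t => g t * h t)]
  simp

/-- The Itô isometry. By bilinearity it suffices to consider two tensor powers, where both integrals
reduce to the `p`-th power of the inner product of the step functions. -/
theorem integral_mul_of_mem_chaosSpan [IsProbabilityMeasure P]
    (hB : IsTwoSidedBrownianMotion B P) {p : ℕ} {F G : ((Fin p → ℝ) → ℝ) × (Ω → ℝ)}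
    (hF : F ∈ chaosSpan B p) (hG : G ∈ chaosSpan B p) :
    ∫ ω, F.2 ω * G.2 ω ∂P = p.factorial * ∫ x, F.1 x * G.1 x := by
  induction hF using Submodule.span_induction with
  | zero => simp
  | smul a x _ hx => simp only [Prod.smul_fst, Prod.smul_snd, Pi.smul_apply, smul_eq_mul, mul_assoc,
      integral_const_mul, hx, mul_left_comm]
  | add x y hx hy ihx ihy =>
    have h1 := memLp_of_mem_chaosSpan hB hx
    have h2 := memLp_of_mem_chaosSpan hB hy
    have h3 := memLp_of_mem_chaosSpan hB hG
    simp only [Prod.fst_add, Prod.snd_add, Pi.add_apply, add_mul]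
    have i1 := integral_add (h1.2.integrable_mul h3.2) (h2.2.integrable_mul h3.2)
    have i2 := integral_add (h1.1.integrable_mul h3.1) (h2.1.integrable_mul h3.1)
    simp only [Pi.mul_apply] at i1 i2
    rw [i1, i2, ihx, ihy, mul_add]
  | mem x h =>
    obtain ⟨φ, rfl⟩ := h
    have h1 := memLp_of_mem_chaosSpan hB (Submodule.subset_span (Set.mem_range_self φ) :
      powPair B p φ ∈ chaosSpan B p)
    induction hG using Submodule.span_induction with
    | zero => simp
    | smul a x _ hx => simp only [Prod.smul_fst, Prod.smul_snd, Pi.smul_apply, smul_eq_mul,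
        mul_left_comm _ a, integral_const_mul, hx]
    | add x y hx hy ihx ihy =>
      have h2 := memLp_of_mem_chaosSpan hB hx
      have h3 := memLp_of_mem_chaosSpan hB hy
      simp only [Prod.fst_add, Prod.snd_add, Pi.add_apply, mul_add]
      have i1 := integral_add (h1.2.integrable_mul h2.2) (h1.2.integrable_mul h3.2)
      have i2 := integral_add (h1.1.integrable_mul h2.1) (h1.1.integrable_mul h3.1)
      simp only [Pi.mul_apply] at i1 i2
      rw [i1, i2, ihx, ihy, mul_add]
    | mem x h =>
      obtain ⟨ψ, rfl⟩ := h
      simp only [powPair]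
      rw [integral_tensorPow_mul]
      have : ∀ ω, (p.factorial * herm p (wiener B φ ω) (-(stepInner φ φ) / 2)) *
          (p.factorial * herm p (wiener B ψ ω) (-(stepInner ψ ψ) / 2)) =
          (p.factorial * p.factorial : ℝ) * (herm p (wiener B φ ω) (-(stepInner φ φ) / 2) *
          herm p (wiener B ψ ω) (-(stepInner ψ ψ) / 2)) := fun ω => by ring
      simp only [this, integral_const_mul, integral_herm_mul_herm hB]
      have := Nat.factorial_ne_zero p
      field_simp
      rfl

theorem eLpNorm_two_eq_ofReal_sqrt {α : Type*} [MeasurableSpace α] {μ : Measure α}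
    {f : α → ℝ} (hf : MemLp f 2 μ) :
    eLpNorm f 2 μ = ENNReal.ofReal √(∫ x, f x * f x ∂μ) := by
  rw [hf.eLpNorm_eq_integral_rpow_norm two_ne_zero ENNReal.ofNat_ne_top, Real.sqrt_eq_rpow]
  simp [← sq]

theorem eLpNorm_of_mem_chaosSpan [IsProbabilityMeasure P]
    (hB : IsTwoSidedBrownianMotion B P) {p : ℕ} {F : ((Fin p → ℝ) → ℝ) × (Ω → ℝ)}
    (hF : F ∈ chaosSpan B p) :
    eLpNorm F.2 2 P = ENNReal.ofReal √p.factorial * eLpNorm F.1 2 volume := by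
  have h := memLp_of_mem_chaosSpan hB hF
  rw [eLpNorm_two_eq_ofReal_sqrt h.1, eLpNorm_two_eq_ofReal_sqrt h.2,
    integral_mul_of_mem_chaosSpan hB hF hF, Real.sqrt_mul (Nat.cast_nonneg _),
    ENNReal.ofReal_mul (Real.sqrt_nonneg _)]

end Chaos

/-! ### Symmetrized tensor products of step functions -/

section Words

variable {ι : Type*} [Fintype ι] [DecidableEq ι] {p : ℕ}

/-- The number of occurrences of each letter in a word. -/
def content (w : Fin p → ι) : ι →₀ ℕ :=
  Finsupp.equivFunOnFinite.symm fun k => Fintype.card {i // w i = k}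

theorem content_apply (w : Fin p → ι) (k : ι) : content w k = Fintype.card {i // w i = k} := rfl

theorem sum_content (w : Fin p → ι) : ∑ k, content w k = p := by
  simp only [content_apply, ← Fintype.card_sigma]
  rw [Fintype.card_congr (Equiv.sigmaFiberEquiv w), Fintype.card_fin]

theorem sum_single_eq_content (w : Fin p → ι) : ∑ i, Finsupp.single (w i) 1 = content w := by
  ext k
  simp [content_apply, Finsupp.single_apply, Fintype.card_subtype, eq_comm]

theorem coeff_tensorPoly (g : ι → ℝ → ℝ) (x : Fin p → ℝ) (β : ι →₀ ℕ) :
    (tensorPoly g x).coeff β =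
      ∑ w : Fin p → ι, if content w = β then ∏ i, g (w i) (x i) else 0 := by
  simp only [tensorPoly, linForm, Finset.prod_univ_sum, Fintype.piFinset_univ,
    MvPolynomial.X, MvPolynomial.C_mul_monomial, mul_one, ← MvPolynomial.monomial_sum_prod,
    MvPolynomial.coeff_sum, MvPolynomial.coeff_monomial, sum_single_eq_content]

/-- Matching the fibres of the two words gives one solution `τ`; the others form a coset of the
stabilizer of `w₀`, which is a product of symmetric groups of its fibres. -/
theorem card_perm_comp_eq (w₀ w : Fin p → ι) (h : content w = content w₀) :
    Fintype.card {σ : Equiv.Perm (Fin p) // w₀ ∘ σ = w} = ∏ k, (content w₀ k).factorial := by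
  have hk : ∀ k, Nonempty ({i // w i = k} ≃ {i // w₀ i = k}) := fun k =>
    ⟨Fintype.equivOfCardEq (DFunLike.congr_fun h k)⟩
  let e : ∀ k, {i // w i = k} ≃ {i // w₀ i = k} := fun k => (hk k).some
  let τ : Equiv.Perm (Fin p) := (Equiv.sigmaFiberEquiv w).symm.trans
    ((Equiv.sigmaCongrRight e).trans (Equiv.sigmaFiberEquiv w₀))
  have hτ : w₀ ∘ τ = w := by
    ext i
    exact (e (w i) ⟨i, rfl⟩).2
  simp only [content_apply]
  rw [← DomMulAct.stabilizer_card w₀]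
  refine Fintype.card_congr ((Equiv.mulRight τ⁻¹).subtypeEquiv fun σ => ?_)
  rw [← hτ]
  constructor
  · intro h
    ext i
    have := congrFun h (τ⁻¹ i)
    simpa using this
  · intro h
    ext i
    have := congrFun h (τ i)
    simpa using this

/-- Permuting variables amounts to permuting the letters of `w₀`. Every word of the same content is
reached equally often, and the sum over such words is a coefficient of `tensorPoly`. -/
theorem sum_perm_tensor (g : ι → ℝ → ℝ) (w₀ : Fin p → ι) (x : Fin p → ℝ) :
    ∑ σ : Equiv.Perm (Fin p), ∏ i, g (w₀ i) (x (σ i)) =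
      (∏ k, ((content w₀ k).factorial : ℝ)) * (tensorPoly g x).coeff (content w₀) := by
  have h1 : ∑ σ : Equiv.Perm (Fin p), ∏ i, g (w₀ i) (x (σ i)) =
      ∑ σ : Equiv.Perm (Fin p), ∏ i, g ((w₀ ∘ σ) i) (x i) := by
    refine Fintype.sum_equiv (Equiv.inv _) _ _ fun σ => ?_
    refine Fintype.prod_equiv σ _ _ fun i => ?_
    simp
  rw [h1, coeff_tensorPoly, Finset.mul_sum,
    ← Finset.sum_fiberwise (s := Finset.univ) (g := fun σ : Equiv.Perm (Fin p) => w₀ ∘ σ)]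
  refine Finset.sum_congr rfl fun w _ => ?_
  rw [Finset.sum_congr rfl fun σ hσ => by rw [(Finset.mem_filter.1 hσ).2], Finset.sum_const,
    nsmul_eq_mul, ← Fintype.card_subtype]
  split_ifs with h
  · rw [card_perm_comp_eq w₀ w h, Nat.cast_prod]
  · rw [mul_zero, Fintype.card_eq_zero_iff.2, Nat.cast_zero, zero_mul]
    refine ⟨fun σ => h ?_⟩
    ext k
    rw [content_apply, content_apply]
    refine Fintype.card_congr (σ.1.subtypeEquiv fun i => ?_)
    have hi : w₀ (σ.1 i) = w i := congrFun σ.2 i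
    rw [hi]

end Words

/-! ### Integrals of off-diagonal elementary functions as Wick products. -/

section Chaos

variable {Ω : Type*} [MeasurableSpace Ω] {B : ℝ → Ω → ℝ} {p : ℕ}

/-- The symmetrization of a tensor product of step functions, with its multiple integral. -/
theorem symmetrization_tensor_mem_chaosSpan {ι : Type*} [Fintype ι] [DecidableEq ι]
    (φ : ι → ℝ →₀ ℝ) (w : Fin p → ι) :
    (symmetrization fun x : Fin p → ℝ => ∏ i, stepFun (φ (w i)) (x i),
      fun ω => (∏ k, ((content w k).factorial : ℝ)) * (wickPoly (fun k => wiener B (φ k) ω)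
        (fun k l => stepInner (φ k) (φ l)) p).coeff (content w)) ∈ chaosSpan B p := by
  have h := (chaosSpan B p).smul_mem ((∏ k, ((content w k).factorial : ℝ)) / p.factorial)
    (coeff_mem_chaosSpan (B := B) φ (content w) (sum_content w))
  convert! h using 1
  have hp := Nat.factorial_ne_zero p
  refine Prod.ext ?_ ?_
  · ext x
    simp only [symmetrization, Prod.smul_fst, Pi.smul_apply, smul_eq_mul]
    rw [sum_perm_tensor (fun k => stepFun (φ k))]
    ring
  · ext ω
    simp only [Prod.smul_snd, Pi.smul_apply, smul_eq_mul]
    field_simp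

/-- A Wick product of pairwise uncorrelated variables is their ordinary product: in `prod_herm` with
`q = 1`, every nonzero `α` carries a vanishing covariance. -/
theorem coeff_wickPoly_one (x : Fin p → ℝ) (c : Fin p → Fin p → ℝ)
    (hc : ∀ k l, c k l = c l k) (h0 : ∀ k l, k ≠ l → c k l = 0) :
    (wickPoly x c p).coeff (content (id : Fin p → Fin p)) = ∏ k, x k := by
  have h := prod_herm 1 x c hc
  simp only [herm_one] at h
  have hmem : (fun _ : Pair p => 0) ∈ A p 1 := (mem_A _).2 fun k => by simp [deg]
  rw [h, Finset.sum_eq_single_of_mem _ hmem]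
  · have h1 : order 1 (fun _ : Pair p => 0) = p := by simp [order, beta0, deg]
    have h2 : beta0Exp 1 (fun _ : Pair p => 0) = content (id : Fin p → Fin p) := by
      ext k
      simp [beta0Exp, beta0, deg, content_apply]
    simp [h1, h2]
  · intro α _ hα
    obtain ⟨e, he⟩ : ∃ e, α e ≠ 0 := by
      by_contra! h'
      exact hα (funext h')
    rw [Finset.prod_eq_zero (Finset.mem_univ e), zero_mul]
    rw [h0 _ _ e.2.ne, zero_pow he, zero_div]

/-- Disjoint sides make the increments of `B` pairwise orthogonal, so their product is the Wick
product attached to the box. This links the defining approximations of the multiple integral to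
Hermite polynomials. -/
theorem offDiagStep_mem_chaosSpan (e : OffDiagStep p) :
    (symmetrization e.toFun, e.integral B) ∈ chaosSpan B p := by
  let φ : Fin e.N → Fin p → ℝ →₀ ℝ := fun r i =>
    Finsupp.single (e.hi r i) 1 - Finsupp.single (e.lo r i) 1
  have hφ : ∀ r i t, stepFun (φ r i) t =
      (Set.Ioc (e.lo r i) (e.hi r i)).indicator (fun _ => (1 : ℝ)) t := fun r i t => by
    rw [← stepInd_sub (e.lo_le_hi r i)]
    simp [φ, stepFun]
  have hW : ∀ r i ω, wiener B (φ r i) ω = B (e.hi r i) ω - B (e.lo r i) ω := fun r i ω => by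
    simp [φ, wiener]
  have hI : ∀ r i j, i ≠ j → stepInner (φ r i) (φ r j) = 0 := fun r i j hij => by
    have : ∀ x, stepFun (φ r i) x * stepFun (φ r j) x = 0 := fun x => by
      rw [hφ, hφ, Set.indicator_apply, Set.indicator_apply]
      by_cases h : x ∈ Set.Ioc (e.lo r i) (e.hi r i)
      · rw [if_neg (Set.disjoint_left.1 (e.disjoint_sides r i j hij) h), mul_zero]
      · rw [if_neg h, zero_mul]
    simp [stepInner, this]
  have key : ∀ r ∈ (Finset.univ : Finset (Fin e.N)), e.coeff r •
      ((symmetrization fun x : Fin p → ℝ => ∏ i, stepFun (φ r i) (x i),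
        fun ω => ∏ i, wiener B (φ r i) ω) : ((Fin p → ℝ) → ℝ) × (Ω → ℝ)) ∈ chaosSpan B p := by
    intro r _
    refine Submodule.smul_mem _ _ ?_
    have := symmetrization_tensor_mem_chaosSpan (B := B) (φ r) id
    simp only [coeff_wickPoly_one _ _ (fun k l => stepInner_comm _ _) (hI r)] at this
    simpa [content_apply] using this
  convert! Submodule.sum_mem _ key using 1
  refine Prod.ext ?_ ?_
  · ext t
    simp only [symmetrization, OffDiagStep.toFun, Prod.fst_sum, Prod.smul_fst, Finset.sum_apply,
      Pi.smul_apply, smul_eq_mul, hφ]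
    rw [Finset.sum_comm, Finset.mul_sum]
    refine Finset.sum_congr rfl fun r _ => ?_
    simp only [← Finset.mul_sum]
    ring
  · ext ω
    simp only [OffDiagStep.integral, Prod.snd_sum, Prod.smul_snd, Finset.sum_apply,
      Pi.smul_apply, smul_eq_mul, hW]

end Chaos

/-! ### Density of the off-diagonal elementary functions -/

section Density

variable {p : ℕ}

theorem memLp_toFun (e : OffDiagStep p) : MemLp e.toFun 2 volume := by
  refine memLp_finsetSum _ fun r _ => MemLp.const_mul (memLp_tensor fun i => ?_) _
  exact memLp_indicator_const _ measurableSet_Ioc _ (Or.inr (by simp))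

/-- An off-diagonal elementary function with boxes indexed by a finite type. -/
def OffDiagStep.ofFintype {J : Type*} [Fintype J] (coeff : J → ℝ) (lo hi : J → Fin p → ℝ)
    (h1 : ∀ r i, lo r i ≤ hi r i)
    (h2 : ∀ r i j, i ≠ j → Disjoint (Set.Ioc (lo r i) (hi r i)) (Set.Ioc (lo r j) (hi r j))) :
    OffDiagStep p where
  N := Fintype.card J
  coeff r := coeff ((Fintype.equivFin J).symm r)
  lo r := lo ((Fintype.equivFin J).symm r)
  hi r := hi ((Fintype.equivFin J).symm r)
  lo_le_hi _ := h1 _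
  disjoint_sides _ := h2 _

theorem OffDiagStep.ofFintype_toFun {J : Type*} [Fintype J] (coeff : J → ℝ)
    (lo hi : J → Fin p → ℝ) (h1 : ∀ r i, lo r i ≤ hi r i)
    (h2 : ∀ r i j, i ≠ j → Disjoint (Set.Ioc (lo r i) (hi r i)) (Set.Ioc (lo r j) (hi r j)))
    (t : Fin p → ℝ) : (OffDiagStep.ofFintype coeff lo hi h1 h2).toFun t =
      ∑ r, coeff r * ∏ i, (Set.Ioc (lo r i) (hi r i)).indicator (fun _ => (1 : ℝ)) (t i) :=
  Fintype.sum_equiv (Fintype.equivFin J).symm _ _ fun _ => rfl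

/-- The lower left corner of the cell of mesh `1 / n` containing `t`. -/
def corner (n : ℕ) (t : Fin p → ℝ) (i : Fin p) : ℝ := ((⌈n * t i⌉ - 1 : ℤ) : ℝ) / n

theorem abs_corner_sub_le {n : ℕ} (hn : n ≠ 0) (t : Fin p → ℝ) (i : Fin p) :
    |corner n t i - t i| ≤ 1 / n := by
  have hn' : (0 : ℝ) < n := by positivity
  have h1 := Int.ceil_lt_add_one (n * t i)
  have h2 := Int.le_ceil (n * t i)
  have : corner n t i - t i = (⌈n * t i⌉ - 1 - n * t i) / n := by
    rw [corner]; push_cast; field_simp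
  rw [this, abs_div, abs_of_pos hn', abs_of_nonpos (by linarith)]
  gcongr
  linarith

theorem tendsto_corner (t : Fin p → ℝ) :
    Tendsto (fun n : ℕ => corner (n + 1) t) atTop (𝓝 t) := by
  refine tendsto_pi_nhds.2 fun i => ?_
  rw [tendsto_iff_dist_tendsto_zero]
  refine squeeze_zero (fun _ => dist_nonneg) (fun n => ?_)
    tendsto_one_div_add_atTop_nhds_zero_nat
  rw [Real.dist_eq]
  exact_mod_cast abs_corner_sub_le n.succ_ne_zero t i

/-- Sampling `f` at the corners of a grid of mesh `1 / n`, and discarding the cells outside a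
bounded range or with two coordinates in the same grid interval, leaves pairwise disjoint sides. -/
theorem exists_offDiagStep_eq (f : (Fin p → ℝ) → ℝ) (R n : ℕ) (hn : n ≠ 0) :
    ∃ e : OffDiagStep p, ∀ t, (e.toFun t = f (corner n t) ∨ e.toFun t = 0) ∧
      ((∀ i, |t i| ≤ R) → Function.Injective (corner n t) → e.toFun t = f (corner n t)) := by
  classical
  have hn' : (0 : ℝ) < n := by positivity
  -- The cell of `t` has index `⌈n * t i⌉ - 1`, hence the extra `1` in the lower bound.
  let S : Finset ℤ := Finset.Icc (-(R * n + 1 : ℤ)) (R * n)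
  let J := {j : Fin p → S // Function.Injective j}
  let e : OffDiagStep p := OffDiagStep.ofFintype (J := J) (fun j => f fun i => ((j.1 i : ℤ) : ℝ) / n)
    (fun j i => ((j.1 i : ℤ) : ℝ) / n) (fun j i => (((j.1 i : ℤ) : ℝ) + 1) / n)
    (fun j i => by gcongr; linarith) (fun j i k hik => by
      rw [Set.disjoint_left]
      intro x hx hx'
      rw [Set.mem_Ioc, div_lt_iff₀ hn', le_div_iff₀ hn'] at hx hx'
      refine hik (j.2 (Subtype.ext ?_))
      have a1 : ((j.1 i : ℤ) : ℝ) < (j.1 k : ℤ) + 1 := by linarith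
      have a2 : ((j.1 k : ℤ) : ℝ) < (j.1 i : ℤ) + 1 := by linarith
      norm_cast at a1 a2
      omega)
  have hbox : ∀ (j : J) (t : Fin p → ℝ),
      ∏ i, (Set.Ioc (((j.1 i : ℤ) : ℝ) / n) ((((j.1 i : ℤ) : ℝ) + 1) / n)).indicator
        (fun _ => (1 : ℝ)) (t i) = if ∀ i, (j.1 i : ℤ) = ⌈n * t i⌉ - 1 then 1 else 0 := by
    intro j t
    have : ∀ i, t i ∈ Set.Ioc (((j.1 i : ℤ) : ℝ) / n) ((((j.1 i : ℤ) : ℝ) + 1) / n) ↔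
        (j.1 i : ℤ) = ⌈n * t i⌉ - 1 := fun i => by
      rw [Set.mem_Ioc, div_lt_iff₀ hn', le_div_iff₀ hn', eq_sub_iff_add_eq, eq_comm,
        Int.ceil_eq_iff]
      push_cast
      rw [add_sub_cancel_right, mul_comm (t i)]
    simp only [Set.indicator_apply, this]
    rw [Finset.prod_ite_zero]
    simp
  have htoFun : ∀ t, e.toFun t = ∑ j : J, if ∀ i, (j.1 i : ℤ) = ⌈n * t i⌉ - 1 then
      f (corner n t) else 0 := fun t => by
    rw [OffDiagStep.ofFintype_toFun]
    refine Finset.sum_congr rfl fun j _ => ?_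
    rw [hbox]
    split_ifs with h
    · rw [mul_one]
      congr 1; ext i
      rw [h i, corner]
    · rw [mul_zero]
  have huniq : ∀ (j j' : J) (t : Fin p → ℝ), (∀ i, (j.1 i : ℤ) = ⌈n * t i⌉ - 1) →
      (∀ i, (j'.1 i : ℤ) = ⌈n * t i⌉ - 1) → j' = j := fun j j' t h h' =>
    Subtype.ext (funext fun i => Subtype.ext ((h' i).trans (h i).symm))
  have hval : ∀ (j : J) (t : Fin p → ℝ), (∀ i, (j.1 i : ℤ) = ⌈n * t i⌉ - 1) →
      e.toFun t = f (corner n t) := fun j t h => by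
    rw [htoFun, Finset.sum_eq_single j, if_pos h]
    · exact fun j' _ hj' => if_neg fun h' => hj' (huniq j j' t h h')
    · simp
  refine ⟨e, fun t => ⟨?_, fun hR hinj => ?_⟩⟩
  · by_cases h : ∃ j : J, ∀ i, (j.1 i : ℤ) = ⌈n * t i⌉ - 1
    · exact Or.inl (hval _ _ h.choose_spec)
    · rw [htoFun]
      exact Or.inr (Finset.sum_eq_zero fun j _ => if_neg fun h' => h ⟨j, h'⟩)
  · have hmem : ∀ i, ⌈n * t i⌉ - 1 ∈ S := fun i => by
      have h := abs_le.1 (hR i)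
      have h1 : n * t i ≤ (R * n : ℤ) := by push_cast; nlinarith
      have h2 : ((-(R * n) : ℤ) : ℝ) ≤ n * t i := by push_cast; nlinarith
      have h3 := Int.ceil_le.2 h1
      have h4 := (Int.cast_le (R := ℝ)).1 (h2.trans (Int.le_ceil _))
      simp only [S, Finset.mem_Icc]
      constructor <;> linarith
    refine hval ⟨fun i => ⟨_, hmem i⟩, fun i k hik => hinj ?_⟩ t fun i => rfl
    have := congrArg Subtype.val hik
    simp only at this
    rw [corner, corner, this]

theorem ae_injective : ∀ᵐ t : Fin p → ℝ, Function.Injective t := by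
  have : ∀ i j : Fin p, i ≠ j → ∀ᵐ t : Fin p → ℝ, t i ≠ t j := by
    intro i j hij
    let s : Submodule ℝ (Fin p → ℝ) :=
      LinearMap.ker ((LinearMap.proj i : (Fin p → ℝ) →ₗ[ℝ] ℝ) - LinearMap.proj j)
    have hs : s ≠ ⊤ := fun h => by
      have : Pi.single i (1 : ℝ) ∈ s := by rw [h]; trivial
      simp [s, hij] at this
    have := Measure.addHaar_submodule volume s hs
    refine measure_mono_null (fun t ht => ?_) this
    simpa [s, sub_eq_zero] using ht
  have h2 : ∀ᵐ t : Fin p → ℝ, ∀ i j : Fin p, i ≠ j → t i ≠ t j := by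
    simp only [ae_all_iff]
    exact this
  filter_upwards [h2] with t ht i j hij
  by_contra hne
  exact ht i j hne hij

/-- Dominated convergence: away from the diagonals, a null set, the coordinates of `t` eventually
lie in different grid intervals, so the sampled values converge to `f t` by continuity. -/
theorem tendsto_offDiagStep_of_hasCompactSupport {f : (Fin p → ℝ) → ℝ} (hf : Continuous f)
    (hc : HasCompactSupport f) : ∃ e : ℕ → OffDiagStep p,
      Tendsto (fun N => eLpNorm (fun t => (e N).toFun t - f t) 2 volume) atTop (𝓝 0) := by
  obtain ⟨R, hR⟩ : ∃ R : ℕ, ∀ t, f t ≠ 0 → ∀ i, |t i| ≤ R := by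
    obtain ⟨r, hr⟩ := hc.isCompact.isBounded.subset_closedBall 0
    obtain ⟨R, hR⟩ := exists_nat_ge r
    refine ⟨R, fun t ht i => ?_⟩
    have := hr (subset_tsupport f ht)
    rw [mem_closedBall_zero_iff] at this
    exact (norm_le_pi_norm t i).trans (this.trans hR)
  obtain ⟨M, hM⟩ := hc.exists_bound_of_continuous hf
  have hM0 : 0 ≤ M := (norm_nonneg _).trans (hM 0)
  have hfL : MemLp f 2 volume := hf.memLp_of_hasCompactSupport hc
  choose e he1 he2 using fun n : ℕ => exists_offDiagStep_eq f R (n + 1) n.succ_ne_zero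
  refine ⟨e, ?_⟩
  have heq : ∀ N, eLpNorm (fun t => (e N).toFun t - f t) 2 volume =
      ENNReal.ofReal √(∫ t, ((e N).toFun t - f t) * ((e N).toFun t - f t)) := fun N =>
    eLpNorm_two_eq_ofReal_sqrt ((memLp_toFun (e N)).sub hfL)
  simp only [heq]
  rw [← ENNReal.ofReal_zero, ← Real.sqrt_zero]
  refine (ENNReal.continuous_ofReal.tendsto _).comp ((Real.continuous_sqrt.tendsto _).comp ?_)
  -- The mesh is at most `1`, so a point outside this ball has its corner outside the box containing
  -- the support of `f`.
  let K : Set (Fin p → ℝ) := Metric.closedBall 0 (R + 1)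
  have hout : ∀ N t, t ∉ K → (e N).toFun t = 0 ∧ f t = 0 := by
    intro N t ht
    have hex : ∃ i, (R : ℝ) + 1 < |t i| := by
      by_contra! h
      refine ht ?_
      rw [mem_closedBall_zero_iff]
      exact (pi_norm_le_iff_of_nonneg (by positivity)).2 h
    obtain ⟨i, hi⟩ := hex
    constructor
    · rcases he1 N t with h | h
      · rw [h]
        by_contra h0
        have h1 := hR _ h0 i
        have h2 := abs_corner_sub_le N.succ_ne_zero t i
        have h3 : (1 : ℝ) / (N.succ : ℕ) ≤ 1 := by
          rw [div_le_one (by positivity)]; exact_mod_cast Nat.succ_pos N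
        have h4 := abs_sub_abs_le_abs_sub (t i) (corner N.succ t i)
        rw [abs_sub_comm] at h4
        have h5 : |corner (N + 1) t i| = |corner N.succ t i| := rfl
        linarith
      · exact h
    · by_contra h0
      have h1 := hR _ h0 i
      linarith
  have hbd : ∀ N t, |(e N).toFun t - f t| ≤ 2 * M := fun N t => by
    have h1 : |(e N).toFun t| ≤ M := by
      rcases he1 N t with h | h
      · rw [h]; exact hM _
      · rw [h, abs_zero]; exact hM0
    have h2 : |f t| ≤ M := hM t
    exact (abs_sub _ _).trans (by linarith)
  have hlim : ∀ᵐ t, Tendsto (fun N => ((e N).toFun t - f t) * ((e N).toFun t - f t)) atTop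
      (𝓝 0) := by
    filter_upwards [ae_injective] with t ht
    have hcor : Tendsto (fun N : ℕ => f (corner (N + 1) t)) atTop (𝓝 (f t)) :=
      (hf.tendsto t).comp (tendsto_corner t)
    have : Tendsto (fun N => (e N).toFun t) atTop (𝓝 (f t)) := by
      -- If `f t = 0`, the point may lie outside the box on which all cells are kept; it is then
      -- enough that each approximation is either the sampled value or zero.
      by_cases h0 : f t = 0
      · rw [h0] at hcor ⊢
        refine squeeze_zero_norm (fun N => ?_) (tendsto_zero_iff_norm_tendsto_zero.1 hcor)
        rcases he1 N t with h | h
        · rw [h]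
        · rw [h, norm_zero]; exact norm_nonneg _
      · refine hcor.congr' ?_
        have hinj : ∀ᶠ N : ℕ in atTop, ∀ i j, i ≠ j → corner (N + 1) t i ≠ corner (N + 1) t j := by
          simp only [eventually_all]
          intro i j hij
          have h1 := tendsto_pi_nhds.1 (tendsto_corner t)
          have := ((h1 i).sub (h1 j)).eventually_ne (sub_ne_zero.2 (ht.ne hij))
          filter_upwards [this] with N hN using sub_ne_zero.1 hN
        filter_upwards [hinj] with N hN
        refine (he2 N t (hR t h0) fun i j hij => ?_).symm
        by_contra hne
        exact hN i j hne hij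
    have h2 := this.sub_const (f t)
    rw [sub_self] at h2
    simpa using h2.mul h2
  have := tendsto_integral_of_dominated_convergence (K.indicator fun _ => 2 * M * (2 * M))
    (fun N => (((memLp_toFun (e N)).sub hfL).1.mul ((memLp_toFun (e N)).sub hfL).1))
    ?_ (fun N => Eventually.of_forall fun t => ?_) hlim
  · simpa using this
  · rw [integrable_indicator_iff measurableSet_closedBall]
    exact integrableOn_const (measure_closedBall_lt_top.ne)
  · by_cases ht : t ∈ K
    · rw [Set.indicator_of_mem ht]
      simp only [Pi.mul_apply, Pi.sub_apply, norm_mul, Real.norm_eq_abs]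
      exact mul_le_mul (hbd N t) (hbd N t) (abs_nonneg _) (by positivity)
    · rw [Set.indicator_of_notMem ht]
      simp [(hout N t ht).1, (hout N t ht).2]

/-- The off-diagonal elementary functions are dense in `L²(ℝ^p)`. -/
theorem exists_tendsto_offDiagStep {f : (Fin p → ℝ) → ℝ} (hf : MemLp f 2 volume) :
    ∃ e : ℕ → OffDiagStep p,
      Tendsto (fun N => eLpNorm (fun t => (e N).toFun t - f t) 2 volume) atTop (𝓝 0) := by
  have key : ∀ ε : ENNReal, ε ≠ 0 → ∃ e : OffDiagStep p,
      eLpNorm (fun t => e.toFun t - f t) 2 volume ≤ ε := by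
    intro ε hε
    have hε2 : ε / 2 ≠ 0 := by simpa using hε
    obtain ⟨g, hgc, hg, hgcont, hgL⟩ :=
      hf.exists_hasCompactSupport_eLpNorm_sub_le ENNReal.ofNat_ne_top hε2
    obtain ⟨e, he⟩ := tendsto_offDiagStep_of_hasCompactSupport hgcont hgc
    obtain ⟨N, hN⟩ := (he.eventually (gt_mem_nhds (pos_iff_ne_zero.2 hε2))).exists
    refine ⟨e N, ?_⟩
    have h1 : (fun t => (e N).toFun t - f t) = (fun t => (e N).toFun t - g t) + (g - f) := by
      ext t; simp
    rw [h1, ← ENNReal.add_halves ε]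
    refine (eLpNorm_add_le ((memLp_toFun _).sub hgL).1 (hgL.sub hf).1 one_le_two).trans ?_
    refine add_le_add hN.le ?_
    rwa [eLpNorm_sub_comm]
  choose e he using fun N : ℕ => key (N : ENNReal)⁻¹ (by simp)
  exact ⟨e, tendsto_of_tendsto_of_tendsto_of_le_of_le tendsto_const_nhds
    ENNReal.tendsto_inv_nat_nhds_zero (fun _ => zero_le) he⟩

end Density

/-! ### Symmetrization -/

theorem measurePreserving_comp_equiv {ι ι' : Type*} [Fintype ι] [Fintype ι'] (e : ι' ≃ ι) :
    MeasurePreserving (fun (x : ι → ℝ) (i : ι') => x (e i)) volume volume := by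
  convert! volume_measurePreserving_piCongrLeft (fun _ : ι' => ℝ) e.symm using 1
  ext x i
  have := Equiv.piCongrLeft_apply_apply (fun _ : ι' => ℝ) e.symm x (e i)
  rw [Equiv.symm_apply_apply] at this
  exact this.symm

section Symmetrization

variable {p : ℕ} {f g : (Fin p → ℝ) → ℝ}

theorem symmetrization_eq_sum (f : (Fin p → ℝ) → ℝ) :
    symmetrization f = (1 / (p.factorial : ℝ)) •
      ∑ σ : Equiv.Perm (Fin p), fun t => f (fun i => t (σ i)) := by
  ext t
  simp [symmetrization]

theorem symmetrization_add (f g : (Fin p → ℝ) → ℝ) :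
    symmetrization (f + g) = symmetrization f + symmetrization g := by
  ext t
  simp [symmetrization, Finset.sum_add_distrib, mul_add]

theorem symmetrization_smul (c : ℝ) (f : (Fin p → ℝ) → ℝ) :
    symmetrization (c • f) = c • symmetrization f := by
  ext t
  simp [symmetrization, ← Finset.mul_sum, mul_left_comm]

theorem symmetrization_sub (f g : (Fin p → ℝ) → ℝ) :
    symmetrization (f - g) = symmetrization f - symmetrization g := by
  ext t
  simp [symmetrization, Finset.sum_sub_distrib, mul_sub]

theorem symmetrization_of_forall_perm
    (hf : ∀ (σ : Equiv.Perm (Fin p)) t, f (fun i => t (σ i)) = f t) : symmetrization f = f := by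
  ext t
  simp [symmetrization, hf, Fintype.card_perm, Nat.factorial_ne_zero]

theorem symmetrization_symmetrization (f : (Fin p → ℝ) → ℝ) :
    symmetrization (symmetrization f) = symmetrization f := by
  refine symmetrization_of_forall_perm fun σ t => ?_
  simp only [symmetrization]
  congr 1
  exact Fintype.sum_equiv (Equiv.mulLeft σ) _ _ fun τ => rfl

theorem symmetrization_ae_eq (hf : ∀ σ : Equiv.Perm (Fin p),
    (fun t : Fin p → ℝ => f (fun i => t (σ i))) =ᵐ[volume] f) : symmetrization f =ᵐ[volume] f := by
  filter_upwards [ae_all_iff.2 hf] with t ht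
  simp [symmetrization, ht, Fintype.card_perm, Nat.factorial_ne_zero]

theorem symmetrization_congr_ae (h : f =ᵐ[volume] g) :
    symmetrization f =ᵐ[volume] symmetrization g := by
  have : ∀ σ : Equiv.Perm (Fin p),
      (fun t : Fin p → ℝ => f (fun i => t (σ i))) =ᵐ[volume] fun t => g (fun i => t (σ i)) :=
    fun σ => (measurePreserving_comp_equiv σ).quasiMeasurePreserving.ae_eq_comp h
  filter_upwards [ae_all_iff.2 this] with t ht
  simp [symmetrization, ht]

theorem memLp_symmetrization (hf : MemLp f 2 volume) : MemLp (symmetrization f) 2 volume := by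
  rw [symmetrization_eq_sum]
  have h : ∀ σ ∈ (Finset.univ : Finset (Equiv.Perm (Fin p))),
      MemLp (fun t : Fin p → ℝ => f (fun i => t (σ i))) 2 volume := fun σ _ =>
    hf.comp_measurePreserving (measurePreserving_comp_equiv σ)
  exact (memLp_finsetSum' _ h).const_smul _

theorem eLpNorm_symmetrization_le (hf : MemLp f 2 volume) :
    eLpNorm (symmetrization f) 2 volume ≤ eLpNorm f 2 volume := by
  have hσ : ∀ σ : Equiv.Perm (Fin p), eLpNorm (fun t : Fin p → ℝ => f (fun i => t (σ i))) 2 volume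
      = eLpNorm f 2 volume := fun σ =>
    eLpNorm_comp_measurePreserving hf.1 (measurePreserving_comp_equiv σ)
  have hm : ∀ σ ∈ (Finset.univ : Finset (Equiv.Perm (Fin p))),
      AEStronglyMeasurable (fun t : Fin p → ℝ => f (fun i => t (σ i))) volume := fun σ _ =>
    (hf.comp_measurePreserving (measurePreserving_comp_equiv σ)).1
  have h := eLpNorm_sum_le hm (p := 2) one_le_two
  simp only [hσ, Finset.sum_const, Finset.card_univ, Fintype.card_perm, Fintype.card_fin,
    nsmul_eq_mul] at h
  rw [symmetrization_eq_sum, eLpNorm_const_smul]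
  refine (mul_le_mul_right h _).trans ?_
  rw [← mul_assoc]
  have : ‖(1 / (p.factorial : ℝ))‖ₑ * (p.factorial : ENNReal) = 1 := by
    rw [Real.enorm_eq_ofReal (by positivity), ← ENNReal.ofReal_natCast,
      ← ENNReal.ofReal_mul (by positivity), one_div, inv_mul_cancel₀
        (by exact_mod_cast p.factorial_ne_zero), ENNReal.ofReal_one]
  rw [this, one_mul]

end Symmetrization

/-! ### The multiple integral -/

section Integral

variable {Ω : Type*} [MeasurableSpace Ω] {P : Measure Ω} {B : ℝ → Ω → ℝ} {p : ℕ}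

theorem symmetrization_of_mem_chaosSpan {F : ((Fin p → ℝ) → ℝ) × (Ω → ℝ)}
    (hF : F ∈ chaosSpan B p) : symmetrization F.1 = F.1 := by
  induction hF using Submodule.span_induction with
  | mem x h =>
    obtain ⟨φ, rfl⟩ := h
    refine symmetrization_of_forall_perm fun σ t => ?_
    exact Fintype.prod_equiv σ _ _ fun i => rfl
  | zero => ext; simp [symmetrization]
  | add x y _ _ hx hy => rw [Prod.fst_add, symmetrization_add, hx, hy]
  | smul a x _ hx => rw [Prod.smul_fst, symmetrization_smul, hx]

variable [IsProbabilityMeasure P] (hB : IsTwoSidedBrownianMotion B P)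

theorem tendsto_eLpNorm_of_sub {α : Type*} [MeasurableSpace α] {μ : Measure α}
    {f g : ℕ → α → ℝ} {h : α → ℝ} (hf : ∀ N, MemLp (f N) 2 μ) (hg : ∀ N, MemLp (g N) 2 μ)
    (hh : MemLp h 2 μ) (h1 : Tendsto (fun N => eLpNorm (f N - g N) 2 μ) atTop (𝓝 0))
    (h2 : Tendsto (fun N => eLpNorm (g N - h) 2 μ) atTop (𝓝 0)) :
    Tendsto (fun N => eLpNorm (f N - h) 2 μ) atTop (𝓝 0) := by
  have := h1.add h2
  rw [add_zero] at this
  refine tendsto_of_tendsto_of_tendsto_of_le_of_le tendsto_const_nhds this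
    (fun _ => zero_le) fun N => ?_
  have e : f N - h = (f N - g N) + (g N - h) := by abel
  simp only
  rw [e]
  exact eLpNorm_add_le ((hf N).sub (hg N)).1 ((hg N).sub hh).1 one_le_two

theorem tendsto_symmetrization {f : (Fin p → ℝ) → ℝ} {g : ℕ → (Fin p → ℝ) → ℝ}
    (hf : MemLp f 2 volume) (hg : ∀ N, MemLp (g N) 2 volume)
    (h : Tendsto (fun N => eLpNorm (g N - f) 2 volume) atTop (𝓝 0)) :
    Tendsto (fun N => eLpNorm (symmetrization (g N) - symmetrization f) 2 volume) atTop (𝓝 0) :=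
  tendsto_of_tendsto_of_tendsto_of_le_of_le tendsto_const_nhds h (fun _ => zero_le) fun N => by
    simp only
    rw [← symmetrization_sub]
    exact eLpNorm_symmetrization_le ((hg N).sub hf)

theorem exists_tendsto_symmetrization {f : (Fin p → ℝ) → ℝ} (hf : MemLp f 2 volume) :
    ∃ e : ℕ → OffDiagStep p,
      Tendsto (fun N => eLpNorm (fun t => (e N).toFun t - symmetrization f t) 2 volume)
        atTop (𝓝 0) ∧
      Tendsto (fun N => eLpNorm (symmetrization (e N).toFun - symmetrization f) 2 volume)
        atTop (𝓝 0) := by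
  obtain ⟨e, he⟩ := exists_tendsto_offDiagStep (memLp_symmetrization hf)
  refine ⟨e, he, ?_⟩
  have := tendsto_symmetrization (memLp_symmetrization hf) (fun N => memLp_toFun (e N)) he
  rwa [symmetrization_symmetrization] at this

include hB

/-- Itô isometry applied to `F N - G N`: the limit of the random components depends only on the
limit of the functions. -/
theorem tendsto_snd_of_tendsto_fst {F G : ℕ → ((Fin p → ℝ) → ℝ) × (Ω → ℝ)}
    (hF : ∀ N, F N ∈ chaosSpan B p) (hG : ∀ N, G N ∈ chaosSpan B p)
    (h : Tendsto (fun N => eLpNorm ((F N).1 - (G N).1) 2 volume) atTop (𝓝 0)) :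
    Tendsto (fun N => eLpNorm ((F N).2 - (G N).2) 2 P) atTop (𝓝 0) := by
  have : ∀ N, eLpNorm ((F N).2 - (G N).2) 2 P =
      ENNReal.ofReal √p.factorial * eLpNorm ((F N).1 - (G N).1) 2 volume := fun N => by
    have := eLpNorm_of_mem_chaosSpan hB ((chaosSpan B p).sub_mem (hF N) (hG N))
    rwa [Prod.snd_sub, Prod.fst_sub] at this
  simp only [this]
  have h' := ENNReal.Tendsto.const_mul h (a := ENNReal.ofReal √p.factorial)
    (Or.inr ENNReal.ofReal_ne_top)
  rwa [mul_zero] at h'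

theorem tendsto_fst_of_tendsto {f : (Fin p → ℝ) → ℝ} (hf : MemLp f 2 volume)
    {F G : ℕ → ((Fin p → ℝ) → ℝ) × (Ω → ℝ)}
    (hF : ∀ N, F N ∈ chaosSpan B p) (hG : ∀ N, G N ∈ chaosSpan B p)
    (h1 : Tendsto (fun N => eLpNorm ((F N).1 - f) 2 volume) atTop (𝓝 0))
    (h2 : Tendsto (fun N => eLpNorm ((G N).1 - f) 2 volume) atTop (𝓝 0)) :
    Tendsto (fun N => eLpNorm ((F N).1 - (G N).1) 2 volume) atTop (𝓝 0) := by
  have := h1.add h2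
  rw [add_zero] at this
  refine tendsto_of_tendsto_of_tendsto_of_le_of_le tendsto_const_nhds this
    (fun _ => zero_le) fun N => ?_
  have e : (F N).1 - (G N).1 = ((F N).1 - f) - ((G N).1 - f) := by abel
  simp only
  rw [e]
  exact eLpNorm_sub_le (((memLp_of_mem_chaosSpan hB (hF N)).1).sub hf).1
    (((memLp_of_mem_chaosSpan hB (hG N)).1).sub hf).1 one_le_two

/-- A characterization of the multiple integral by approximations in `chaosSpan`. -/
theorem isMultipleIntegral_iff {f : (Fin p → ℝ) → ℝ} {F : Ω → ℝ} :
    IsMultipleIntegral B P p f F ↔ MemLp f 2 volume ∧ MemLp F 2 P ∧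
      ∃ K : ℕ → ((Fin p → ℝ) → ℝ) × (Ω → ℝ), (∀ N, K N ∈ chaosSpan B p) ∧
        Tendsto (fun N => eLpNorm ((K N).1 - symmetrization f) 2 volume) atTop (𝓝 0) ∧
        Tendsto (fun N => eLpNorm ((K N).2 - F) 2 P) atTop (𝓝 0) := by
  constructor
  · rintro ⟨hf, hF, e, h1, h2⟩
    refine ⟨hf, hF, fun N => (symmetrization (e N).toFun, (e N).integral B),
      fun N => offDiagStep_mem_chaosSpan (e N), ?_, h2⟩
    have := tendsto_symmetrization (memLp_symmetrization hf) (fun N => memLp_toFun (e N)) h1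
    rwa [symmetrization_symmetrization] at this
  · rintro ⟨hf, hF, K, hK, h1, h2⟩
    obtain ⟨e, he, he'⟩ := exists_tendsto_symmetrization hf
    refine ⟨hf, hF, e, he, ?_⟩
    let E : ℕ → ((Fin p → ℝ) → ℝ) × (Ω → ℝ) :=
      fun N => (symmetrization (e N).toFun, (e N).integral B)
    have hE : ∀ N, E N ∈ chaosSpan B p := fun N => offDiagStep_mem_chaosSpan (e N)
    -- Elementary and arbitrary approximations of the same symmetrized function have asymptotically
    -- equal integrals, so the elementary ones inherit the limit `F`.
    have h3 := tendsto_snd_of_tendsto_fst hB hE hK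
        (tendsto_fst_of_tendsto hB (memLp_symmetrization hf) hE hK he' h1)
    exact tendsto_eLpNorm_of_sub (fun N => (memLp_of_mem_chaosSpan hB (hE N)).2)
      (fun N => (memLp_of_mem_chaosSpan hB (hK N)).2) hF h3 h2

/-- The isometry carries the Cauchy property of the approximating functions over to their integrals,
and `L²(P)` is complete. -/
theorem exists_isMultipleIntegral {f : (Fin p → ℝ) → ℝ} (hf : MemLp f 2 volume) :
    ∃ F, IsMultipleIntegral B P p f F := by
  obtain ⟨e, he, he'⟩ := exists_tendsto_symmetrization hf
  let K : ℕ → ((Fin p → ℝ) → ℝ) × (Ω → ℝ) :=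
    fun N => (symmetrization (e N).toFun, (e N).integral B)
  have hK : ∀ N, K N ∈ chaosSpan B p := fun N => offDiagStep_mem_chaosSpan (e N)
  have hL := fun N => memLp_of_mem_chaosSpan hB (hK N)
  have hc : CauchySeq fun N => (hL N).1.toLp (K N).1 :=
    ((Lp.tendsto_Lp_iff_tendsto_eLpNorm'' _ (fun N => (hL N).1) _
      (memLp_symmetrization hf)).2 he').cauchySeq
  have hc' : CauchySeq fun N => (hL N).2.toLp (K N).2 := by
    rw [EMetric.cauchySeq_iff_le_tendsto_0] at hc ⊢
    obtain ⟨b, hb, hb0⟩ := hc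
    refine ⟨fun N => ENNReal.ofReal √p.factorial * b N, fun n m N hn hm => ?_, ?_⟩
    · have := hb n m N hn hm
      rw [Lp.edist_toLp_toLp] at this ⊢
      have h1 := eLpNorm_of_mem_chaosSpan hB ((chaosSpan B p).sub_mem (hK n) (hK m))
      simp only [Prod.snd_sub, Prod.fst_sub] at h1
      rw [h1]
      exact mul_le_mul_right this _
    · have h' := ENNReal.Tendsto.const_mul hb0 (a := ENNReal.ofReal √p.factorial)
        (Or.inr ENNReal.ofReal_ne_top)
      rwa [mul_zero] at h'
  obtain ⟨F, hF⟩ := cauchySeq_tendsto_of_complete hc'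
  refine ⟨F, (isMultipleIntegral_iff hB).2 ⟨hf, Lp.memLp F, K, hK, he', ?_⟩⟩
  refine (Lp.tendsto_Lp_iff_tendsto_eLpNorm'' _ (fun N => (hL N).2) _ (Lp.memLp F)).1 ?_
  rwa [Lp.toLp_coeFn]

theorem isMultipleIntegral_of_mem_chaosSpan {f : (Fin p → ℝ) → ℝ} {F : Ω → ℝ}
    (hf : MemLp f 2 volume) (h : (symmetrization f, F) ∈ chaosSpan B p) :
    IsMultipleIntegral B P p f F :=
  (isMultipleIntegral_iff hB).2 ⟨hf, (memLp_of_mem_chaosSpan hB h).2,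
    fun _ => (symmetrization f, F), fun _ => h, by simp, by simp⟩

theorem IsMultipleIntegral.add {f g : (Fin p → ℝ) → ℝ} {F G : Ω → ℝ}
    (hf : IsMultipleIntegral B P p f F) (hg : IsMultipleIntegral B P p g G) :
    IsMultipleIntegral B P p (f + g) (F + G) := by
  obtain ⟨hf, hF, K, hK, h1, h2⟩ := (isMultipleIntegral_iff hB).1 hf
  obtain ⟨hg, hG, L, hL, h3, h4⟩ := (isMultipleIntegral_iff hB).1 hg
  refine (isMultipleIntegral_iff hB).2 ⟨hf.add hg, hF.add hG, fun N => K N + L N,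
    fun N => Submodule.add_mem _ (hK N) (hL N), ?_, ?_⟩
  · have := h1.add h3
    rw [add_zero] at this
    refine tendsto_of_tendsto_of_tendsto_of_le_of_le tendsto_const_nhds this
      (fun _ => zero_le) fun N => ?_
    simp only [Prod.fst_add, symmetrization_add, add_sub_add_comm]
    exact eLpNorm_add_le ((memLp_of_mem_chaosSpan hB (hK N)).1.sub (memLp_symmetrization hf)).1
      ((memLp_of_mem_chaosSpan hB (hL N)).1.sub (memLp_symmetrization hg)).1 one_le_two
  · have := h2.add h4
    rw [add_zero] at this
    refine tendsto_of_tendsto_of_tendsto_of_le_of_le tendsto_const_nhds this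
      (fun _ => zero_le) fun N => ?_
    simp only [Prod.snd_add, add_sub_add_comm]
    exact eLpNorm_add_le ((memLp_of_mem_chaosSpan hB (hK N)).2.sub hF).1
      ((memLp_of_mem_chaosSpan hB (hL N)).2.sub hG).1 one_le_two

theorem IsMultipleIntegral.const_smul {f : (Fin p → ℝ) → ℝ} {F : Ω → ℝ} (c : ℝ)
    (hf : IsMultipleIntegral B P p f F) : IsMultipleIntegral B P p (c • f) (c • F) := by
  obtain ⟨hf, hF, K, hK, h1, h2⟩ := (isMultipleIntegral_iff hB).1 hf
  refine (isMultipleIntegral_iff hB).2 ⟨hf.const_smul c, hF.const_smul c, fun N => c • K N,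
    fun N => Submodule.smul_mem _ _ (hK N), ?_, ?_⟩
  · simp only [Prod.smul_fst, symmetrization_smul, ← smul_sub, eLpNorm_const_smul]
    simpa using ENNReal.Tendsto.const_mul h1 (a := ‖c‖ₑ) (Or.inr enorm_ne_top)
  · simp only [Prod.smul_snd, ← smul_sub, eLpNorm_const_smul]
    simpa using ENNReal.Tendsto.const_mul h2 (a := ‖c‖ₑ) (Or.inr enorm_ne_top)

theorem IsMultipleIntegral.congr_left {f g : (Fin p → ℝ) → ℝ} {F : Ω → ℝ}
    (hf : IsMultipleIntegral B P p f F) (hfg : f =ᵐ[volume] g) :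
    IsMultipleIntegral B P p g F := by
  obtain ⟨hf, hF, K, hK, h1, h2⟩ := (isMultipleIntegral_iff hB).1 hf
  refine (isMultipleIntegral_iff hB).2 ⟨hf.ae_eq hfg, hF, K, hK, ?_, h2⟩
  refine h1.congr fun N => eLpNorm_congr_ae ?_
  exact EventuallyEq.rfl.sub (symmetrization_congr_ae hfg)

/-- Only an inequality, because symmetrization may decrease the norm. It provides both almost sure
uniqueness (with `f = 0`) and continuity of the multiple integral. -/
theorem IsMultipleIntegral.eLpNorm_le {f : (Fin p → ℝ) → ℝ} {F : Ω → ℝ}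
    (hf : IsMultipleIntegral B P p f F) :
    eLpNorm F 2 P ≤ ENNReal.ofReal √p.factorial * eLpNorm f 2 volume := by
  obtain ⟨hf, hF, K, hK, h1, h2⟩ := (isMultipleIntegral_iff hB).1 hf
  have hs := memLp_symmetrization hf
  have hb : ∀ N, eLpNorm F 2 P ≤ eLpNorm ((K N).2 - F) 2 P + ENNReal.ofReal √p.factorial *
      (eLpNorm ((K N).1 - symmetrization f) 2 volume + eLpNorm f 2 volume) := by
    intro N
    have hN := memLp_of_mem_chaosSpan hB (hK N)
    have e1 : F = (K N).2 - ((K N).2 - F) := by abel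
    have e2 : (K N).1 = ((K N).1 - symmetrization f) + symmetrization f := by abel
    calc eLpNorm F 2 P ≤ eLpNorm (K N).2 2 P + eLpNorm ((K N).2 - F) 2 P := by
          conv_lhs => rw [e1]
          exact eLpNorm_sub_le hN.2.1 (hN.2.sub hF).1 one_le_two
      _ ≤ _ := by
          rw [eLpNorm_of_mem_chaosSpan hB (hK N), add_comm]
          gcongr
          conv_lhs => rw [e2]
          refine (eLpNorm_add_le (hN.1.sub hs).1 hs.1 one_le_two).trans ?_
          gcongr
          exact eLpNorm_symmetrization_le hf
  have ht := h2.add (ENNReal.Tendsto.const_mul (h1.add_const (eLpNorm f 2 volume))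
    (a := ENNReal.ofReal √p.factorial) (Or.inr ENNReal.ofReal_ne_top))
  rw [zero_add, zero_add] at ht
  exact ge_of_tendsto' ht hb

theorem IsMultipleIntegral.ae_eq {f : (Fin p → ℝ) → ℝ} {F G : Ω → ℝ}
    (hF : IsMultipleIntegral B P p f F) (hG : IsMultipleIntegral B P p f G) : F =ᵐ[P] G := by
  have h := (hF.add hB (hG.const_smul hB (-1))).eLpNorm_le hB
  have h0 : f + (-1 : ℝ) • f = 0 := by simp
  rw [h0, eLpNorm_zero, mul_zero, nonpos_iff_eq_zero, eLpNorm_eq_zero_iff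
    ((hF.2.1.add (hG.2.1.const_smul _)).1) two_ne_zero] at h
  filter_upwards [h] with ω hω
  simp only [Pi.add_apply, Pi.smul_apply, smul_eq_mul, Pi.zero_apply] at hω
  linarith

theorem isMultipleIntegral_multipleIntegral {f : (Fin p → ℝ) → ℝ} (hf : MemLp f 2 volume) :
    IsMultipleIntegral B P p f (multipleIntegral B P p f) := by
  rw [multipleIntegral, dif_pos (exists_isMultipleIntegral hB hf)]
  exact (exists_isMultipleIntegral hB hf).choose_spec

theorem IsMultipleIntegral.multipleIntegral_ae_eq {f : (Fin p → ℝ) → ℝ} {F : Ω → ℝ}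
    (hF : IsMultipleIntegral B P p f F) : multipleIntegral B P p f =ᵐ[P] F :=
  (isMultipleIntegral_multipleIntegral hB hF.1).ae_eq hB hF

end Integral

/-! ### Integral inequalities for products of functions of overlapping sets of variables -/

section Finner

open ENNReal

variable {V K : Type*} [Fintype V] [DecidableEq V] [Fintype K] [DecidableEq K]

theorem lmarginal_update_of_forall {f : (V → ℝ) → ℝ≥0∞} (hfm : Measurable f) {w : V}
    (hf : ∀ x y, f (Function.update x w y) = f x) (T : Finset V) (x : V → ℝ) (y : ℝ) :
    (∫⋯∫⁻_T, f ∂fun _ => volume) (Function.update x w y) = (∫⋯∫⁻_T, f ∂fun _ => volume) x := by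
  by_cases hw : w ∈ T
  · exact lmarginal_update_of_mem _ hw f x y
  · rw [lmarginal_update_of_notMem hfm hw]
    congr 1
    ext x
    exact hf x y

theorem lintegral_mul_sqrt_le {f g : ℝ → ℝ≥0∞} (hf : Measurable f) (hg : Measurable g) :
    ∫⁻ y, f y * g y ≤ (∫⁻ y, f y ^ 2) ^ (1 / 2 : ℝ) * (∫⁻ y, g y ^ 2) ^ (1 / 2 : ℝ) := by
  have := ENNReal.lintegral_mul_le_Lp_mul_Lq volume (p := 2) (q := 2)
    (by norm_num [Real.holderConjugate_iff]) hf.aemeasurable hg.aemeasurable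
  simpa using this

theorem sqrt_pow_two (a : ℝ≥0∞) : (a ^ (1 / 2 : ℝ)) ^ 2 = a := by
  rw [← ENNReal.rpow_natCast, ← ENNReal.rpow_mul]; simp

/-- If each variable of `T` occurs in exactly two of the functions `f k`, then the integral of the
product is at most the product of the `L²` norms. -/
theorem lmarginal_prod_sq_le (S : K → Finset V) (T : Finset V)
    (hT : ∀ v ∈ T, ∃ a b, a ≠ b ∧ ∀ k, v ∈ S k ↔ k = a ∨ k = b)
    (f : K → (V → ℝ) → ℝ≥0∞) (hf : ∀ k, Measurable (f k))
    (hfS : ∀ k, ∀ v ∉ S k, ∀ x y, f k (Function.update x v y) = f k x) (x : V → ℝ) :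
    (∫⋯∫⁻_T, (fun x => ∏ k, f k x) ∂fun _ => volume) x ^ 2 ≤
      ∏ k, (∫⋯∫⁻_(T ∩ S k), (fun x => f k x ^ 2) ∂fun _ => volume) x := by
  induction T using Finset.induction_on generalizing f x with
  | empty => simp [Finset.prod_pow]
  | insert v T hv ih =>
    obtain ⟨a, b, hab, hS⟩ := hT v (Finset.mem_insert_self v T)
    -- After integration over `v`, the two factors that depend on `v` are replaced by their `L²`
    -- norms in that variable, by Cauchy-Schwarz; the others come out of the integral. The induction
    -- hypothesis is applied to the new family.
    let f' : K → (V → ℝ) → ℝ≥0∞ := fun k x =>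
      if v ∈ S k then (∫⁻ y, f k (Function.update x v y) ^ 2) ^ (1 / 2 : ℝ) else f k x
    have hmeas : ∀ k, Measurable fun x : V → ℝ => ∫⁻ y, f k (Function.update x v y) ^ 2 :=
      fun k => by
        have := Measurable.lmarginal (fun _ : V => volume) (s := {v}) ((hf k).pow_const 2)
        simpa only [lmarginal_singleton] using this
    have hf' : ∀ k, Measurable (f' k) := fun k => by
      by_cases h : v ∈ S k
      · simp only [f', h, if_true]
        exact (hmeas k).pow_const _
      · simpa only [f', h, if_false] using hf k
    have hfS' : ∀ k, ∀ w ∉ S k, ∀ x y, f' k (Function.update x w y) = f' k x := by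
      intro k w hw x y
      by_cases h : v ∈ S k
      · have hvw : v ≠ w := fun e => hw (e ▸ h)
        simp only [f', h, if_true]
        simp only [Function.update_comm hvw.symm, hfS k w hw]
      · simp only [f', h, if_false, hfS k w hw]
    have hstep : ∀ x : V → ℝ, ∫⁻ y, ∏ k, f k (Function.update x v y) ≤ ∏ k, f' k x := by
      intro x
      have hsplit : ∀ g : K → ℝ≥0∞, ∏ k, g k =
          g a * g b * ∏ k ∈ (Finset.univ.erase a).erase b, g k := fun g => by
        rw [mul_assoc, Finset.mul_prod_erase _ _ (by simp [hab.symm]),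
          Finset.mul_prod_erase _ _ (Finset.mem_univ _)]
      have hrest : ∀ y, ∏ k ∈ (Finset.univ.erase a).erase b, f k (Function.update x v y) =
          ∏ k ∈ (Finset.univ.erase a).erase b, f' k x := fun y =>
        Finset.prod_congr rfl fun k hk => by
          have : v ∉ S k := by
            rw [hS]; simp at hk; tauto
          simp only [f', this, if_false, hfS k v this]
      have ha : v ∈ S a := (hS a).2 (Or.inl rfl)
      have hb : v ∈ S b := (hS b).2 (Or.inr rfl)
      have hm : ∀ k, Measurable fun y => f k (Function.update x v y) := fun k =>
        (hf k).comp (measurable_update x)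
      simp only [hsplit, hrest]
      have hab : Measurable fun y => f a (Function.update x v y) * f b (Function.update x v y) :=
        (hm a).mul (hm b)
      rw [lintegral_mul_const _ hab]
      refine mul_le_mul_left ?_ _
      simp only [f', ha, hb, if_true]
      exact lintegral_mul_sqrt_le (hm a) (hm b)
    have hprodm : Measurable fun x => ∏ k, f k x := Finset.measurable_fun_prod _ fun k _ => hf k
    calc (∫⋯∫⁻_insert v T, (fun x => ∏ k, f k x) ∂fun _ => volume) x ^ 2
        ≤ (∫⋯∫⁻_T, (fun x => ∏ k, f' k x) ∂fun _ => volume) x ^ 2 := by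
          rw [lmarginal_insert' _ hprodm hv]
          gcongr
          exact lmarginal_mono hstep x
      _ ≤ _ := ih (fun w hw => hT w (Finset.mem_insert_of_mem hw)) f' hf' hfS' x
      _ = _ := by
          refine Finset.prod_congr rfl fun k _ => ?_
          by_cases h : v ∈ S k
          · rw [Finset.insert_inter_of_mem h, lmarginal_insert' _ ((hf k).pow_const 2)
              (by simp [hv])]
            simp only [f', h, if_true, sqrt_pow_two]
          · rw [Finset.insert_inter_of_notMem h]
            simp only [f', h, if_false]

/-- If each variable of `T` occurs in exactly one of the functions `f k`, then the integral of the
product is the product of the integrals. -/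
theorem lmarginal_prod_eq (S : K → Finset V) (T : Finset V)
    (hT : ∀ v ∈ T, ∃ a, ∀ k, v ∈ S k ↔ k = a)
    (f : K → (V → ℝ) → ℝ≥0∞) (hf : ∀ k, Measurable (f k))
    (hfS : ∀ k, ∀ v ∉ S k, ∀ x y, f k (Function.update x v y) = f k x) (x : V → ℝ) :
    (∫⋯∫⁻_T, (fun x => ∏ k, f k x) ∂fun _ => volume) x =
      ∏ k, (∫⋯∫⁻_(T ∩ S k), f k ∂fun _ => volume) x := by
  induction T using Finset.induction_on generalizing f x with
  | empty => simp
  | insert v T hv ih =>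
    obtain ⟨a, hS⟩ := hT v (Finset.mem_insert_self v T)
    let f' : K → (V → ℝ) → ℝ≥0∞ := fun k x =>
      if v ∈ S k then ∫⁻ y, f k (Function.update x v y) else f k x
    have hmeas : ∀ k, Measurable fun x : V → ℝ => ∫⁻ y, f k (Function.update x v y) :=
      fun k => by
        have := Measurable.lmarginal (fun _ : V => volume) (s := {v}) (hf k)
        simpa only [lmarginal_singleton] using this
    have hf' : ∀ k, Measurable (f' k) := fun k => by
      by_cases h : v ∈ S k
      · simpa only [f', h, if_true] using hmeas k
      · simpa only [f', h, if_false] using hf k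
    have hfS' : ∀ k, ∀ w ∉ S k, ∀ x y, f' k (Function.update x w y) = f' k x := by
      intro k w hw x y
      by_cases h : v ∈ S k
      · have hvw : v ≠ w := fun e => hw (e ▸ h)
        simp only [f', h, if_true]
        simp only [Function.update_comm hvw.symm, hfS k w hw]
      · simp only [f', h, if_false, hfS k w hw]
    have hstep : ∀ x : V → ℝ, ∫⁻ y, ∏ k, f k (Function.update x v y) = ∏ k, f' k x := by
      intro x
      have hrest : ∀ y, ∏ k ∈ Finset.univ.erase a, f k (Function.update x v y) =
          ∏ k ∈ Finset.univ.erase a, f' k x := fun y =>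
        Finset.prod_congr rfl fun k hk => by
          have : v ∉ S k := by
            rw [hS]; simpa using hk
          simp only [f', this, if_false, hfS k v this]
      have ha : v ∈ S a := (hS a).2 rfl
      simp only [← Finset.mul_prod_erase Finset.univ _ (Finset.mem_univ a), hrest]
      have hma : Measurable fun y => f a (Function.update x v y) :=
        (hf a).comp (measurable_update x)
      rw [lintegral_mul_const _ hma]
      simp only [f', ha, if_true]
    have hprodm : Measurable fun x => ∏ k, f k x := Finset.measurable_fun_prod _ fun k _ => hf k
    rw [lmarginal_insert' _ hprodm hv]
    simp only [hstep]
    rw [ih (fun w hw => hT w (Finset.mem_insert_of_mem hw)) f' hf' hfS' x]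
    refine Finset.prod_congr rfl fun k _ => ?_
    by_cases h : v ∈ S k
    · rw [Finset.insert_inter_of_mem h, lmarginal_insert' _ (hf k) (by simp [hv])]
      simp only [f', h, if_true]
    · rw [Finset.insert_inter_of_notMem h]
      simp only [f', h, if_false]

theorem lmarginal_image_comp {Q : Type*} [Fintype Q] [DecidableEq Q] {τ : Q → V}
    (hτ : Function.Injective τ) {g : (Q → ℝ) → ℝ≥0∞} (hg : Measurable g) (x : V → ℝ) :
    (∫⋯∫⁻_(Finset.univ.image τ), (fun x => g (fun l => x (τ l))) ∂fun _ => volume) x =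
      ∫⁻ y, g y := by
  have := lmarginal_image (μ := fun _ : V => (volume : Measure ℝ)) hτ Finset.univ hg x
  rw [lmarginal_univ] at this
  exact this

/-- Selecting coordinates does not preserve the infinite Lebesgue measure, but null sets pull back
to null sets: integrating the selected coordinates first gives zero. -/
theorem quasiMeasurePreserving_comp {Q : Type*} [Fintype Q] {τ : Q → V}
    (hτ : Function.Injective τ) :
    Measure.QuasiMeasurePreserving (fun (x : V → ℝ) l => x (τ l)) volume volume := by
  classical
  have hm : Measurable fun (x : V → ℝ) l => x (τ l) :=
    measurable_pi_lambda _ fun l => measurable_pi_apply _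
  refine ⟨hm, Measure.AbsolutelyContinuous.mk fun N hN h0 => ?_⟩
  rw [Measure.map_apply hm hN, ← lintegral_indicator_one (hm hN)]
  have hg : Measurable (N.indicator (1 : (Q → ℝ) → ℝ≥0∞)) := measurable_one.indicator hN
  have e : ((fun (x : V → ℝ) l => x (τ l)) ⁻¹' N).indicator (1 : (V → ℝ) → ℝ≥0∞) =
      fun x => N.indicator 1 (fun l => x (τ l)) := by
    ext x; simp [Set.indicator_apply]
  have hgm : Measurable fun x : V → ℝ => N.indicator (1 : (Q → ℝ) → ℝ≥0∞) (fun l => x (τ l)) :=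
    hg.comp hm
  rw [e, volume_pi, lintegral_eq_lmarginal_univ 0,
    ← Finset.sdiff_union_of_subset (Finset.subset_univ (Finset.univ.image τ)),
    lmarginal_union _ _ hgm Finset.sdiff_disjoint]
  have : (∫⋯∫⁻_(Finset.univ.image τ), (fun x : V → ℝ => N.indicator 1 (fun l => x (τ l)))
      ∂fun _ => volume) = fun _ => (0 : ℝ≥0∞) := by
    ext x
    rw [lmarginal_image_comp hτ hg, lintegral_indicator_one hN, h0]
  rw [this]
  simp [lmarginal]

/-- The Cauchy-Schwarz inequality for contractions. -/
theorem lintegral_contraction_sq_le {VS VX Q : Type*} [Fintype VS] [Fintype VX] [Fintype Q]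
    (τ : K → Q → VS ⊕ VX) (hτ : ∀ k, Function.Injective (τ k))
    (hS : ∀ v, ∃ a b, a ≠ b ∧ ∀ k, Sum.inl v ∈ Set.range (τ k) ↔ k = a ∨ k = b)
    (hX : ∀ v, ∃ a, ∀ k, Sum.inr v ∈ Set.range (τ k) ↔ k = a)
    (g : K → (Q → ℝ) → ℝ≥0∞) (hg : ∀ k, Measurable (g k)) :
    ∫⁻ ξ : VX → ℝ, (∫⁻ s : VS → ℝ, ∏ k, g k (fun l => Sum.elim s ξ (τ k l))) ^ 2 ≤
      ∏ k, ∫⁻ x, g k x ^ 2 := by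
  classical
  let S : K → Finset (VS ⊕ VX) := fun k => Finset.univ.image (τ k)
  have hmemS : ∀ k v, v ∈ S k ↔ v ∈ Set.range (τ k) := fun k v => by simp [S]
  let L : Finset (VS ⊕ VX) := Finset.univ.image Sum.inl
  let R : Finset (VS ⊕ VX) := Finset.univ.image Sum.inr
  have hLR : Disjoint R L := by
    rw [Finset.disjoint_left]; rintro (v | v) <;> simp [L, R]
  have hLRu : ∀ v, v ∈ R ∨ v ∈ L := by rintro (v | v) <;> simp [L, R]
  let f : K → (VS ⊕ VX → ℝ) → ℝ≥0∞ := fun k x => g k fun l => x (τ k l)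
  have hf : ∀ k, Measurable (f k) := fun k =>
    (hg k).comp (measurable_pi_lambda _ fun l => measurable_pi_apply _)
  have hfS : ∀ k, ∀ v ∉ S k, ∀ x y, f k (Function.update x v y) = f k x := by
    intro k v hv x y
    simp only [f]
    congr 1; ext l
    rw [Function.update_of_ne]
    rintro rfl
    exact hv ((hmemS _ _).2 ⟨l, rfl⟩)
  -- Contracted variables: each is shared by two factors, so the squared integral is at most a
  -- product of partial `L²` integrals.
  have h1 := lmarginal_prod_sq_le S L (fun v hv => by
    obtain ⟨v, -, rfl⟩ := Finset.mem_image.1 hv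
    simpa only [hmemS] using hS v) f hf hfS
  let φ : K → (VS ⊕ VX → ℝ) → ℝ≥0∞ := fun k =>
    ∫⋯∫⁻_(L ∩ S k), (fun x => f k x ^ 2) ∂fun _ => volume
  have hφ : ∀ k, Measurable (φ k) := fun k => ((hf k).pow_const 2).lmarginal _
  -- Free variables: each belongs to one factor, so the remaining integral splits exactly into the
  -- full `L²` integrals. The base point `0` is irrelevant, as every variable gets integrated.
  have h2 := lmarginal_prod_eq S R (fun v hv => by
    obtain ⟨v, -, rfl⟩ := Finset.mem_image.1 hv
    simpa only [hmemS] using hX v) φ hφ (fun k v hv x y =>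
      lmarginal_update_of_forall ((hf k).pow_const 2) (fun x y => by rw [hfS k v hv]) _ x y) 0
  have h3 : ∀ k, (∫⋯∫⁻_(R ∩ S k), φ k ∂fun _ => volume) 0 = ∫⁻ x, g k x ^ 2 := fun k => by
    rw [← lmarginal_union _ _ ((hf k).pow_const 2)
      (hLR.mono Finset.inter_subset_left Finset.inter_subset_left), ← Finset.union_inter_distrib_right,
      Finset.inter_eq_right.2 fun v _ => Finset.mem_union.2 (hLRu v)]
    exact lmarginal_image_comp (hτ k) ((hg k).pow_const 2) 0
  simp only [h3] at h2
  have hprodm : Measurable fun x => ∏ k, f k x := Finset.measurable_fun_prod _ fun k _ => hf k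
  have h4 : ∀ x : VS ⊕ VX → ℝ, (∫⋯∫⁻_L, (fun x => ∏ k, f k x) ∂fun _ => volume) x =
      ∫⁻ s : VS → ℝ, ∏ k, g k (fun l => Sum.elim s (fun v => x (Sum.inr v)) (τ k l)) := by
    intro x
    have hm : Measurable fun s : VS → ℝ =>
        ∏ k, g k (fun l => Sum.elim s (fun v => x (Sum.inr v)) (τ k l)) :=
      Finset.measurable_fun_prod _ fun k _ => (hg k).comp (measurable_pi_lambda _ fun l => by
        cases τ k l <;> simp <;> fun_prop)
    rw [← lmarginal_image_comp Sum.inl_injective hm x]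
    simp only [lmarginal]
    refine lintegral_congr fun y => ?_
    refine Finset.prod_congr rfl fun k _ => ?_
    simp only [f]
    congr 1; ext l
    cases hl : τ k l with
    | inl v => rfl
    | inr v => simp [Function.updateFinset, L]
  have h5 : Measurable fun ξ : VX → ℝ =>
      (∫⁻ s : VS → ℝ, ∏ k, g k (fun l => Sum.elim s ξ (τ k l))) ^ 2 := by
    refine Measurable.pow_const ?_ 2
    refine Measurable.lintegral_prod_right' (f := fun p : (VX → ℝ) × (VS → ℝ) =>
      ∏ k, g k (fun l => Sum.elim p.2 p.1 (τ k l))) ?_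
    exact Finset.measurable_fun_prod _ fun k _ => (hg k).comp (measurable_pi_lambda _ fun l => by
        cases τ k l <;> simp <;> fun_prop)
  calc _ = (∫⋯∫⁻_R, (fun x => (∫⋯∫⁻_L, (fun x => ∏ k, f k x) ∂fun _ => volume) x ^ 2)
        ∂fun _ => volume) 0 := by
        simp only [h4]
        exact (lmarginal_image_comp Sum.inr_injective h5 0).symm
    _ ≤ (∫⋯∫⁻_R, (fun x => ∏ k, φ k x) ∂fun _ => volume) 0 := lmarginal_mono h1 0
    _ = _ := h2

end Finner

/-! ### Contractions of square integrable functions -/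

section GeneralContraction

open ENNReal

theorem eLpNorm_two_pow_two {α : Type*} [MeasurableSpace α] {μ : Measure α} (f : α → ℝ) :
    eLpNorm f 2 μ ^ 2 = ∫⁻ x, ‖f x‖ₑ ^ 2 ∂μ := by
  have := eLpNorm_nnreal_pow_eq_lintegral (f := f) (μ := μ) (p := 2) two_ne_zero
  simpa using this

variable {VS VX Q K : Type*} [Fintype VS] [Fintype VX] [Fintype Q] [Fintype K]
  {τ : K → Q → VS ⊕ VX}

/-- The integral of `∏ k, g k (x ∘ τ k)` over the variables indexed by `VS`. -/
def generalContraction (τ : K → Q → VS ⊕ VX) (g : K → (Q → ℝ) → ℝ) (ξ : VX → ℝ) : ℝ :=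
  ∫ s : VS → ℝ, ∏ k, g k (fun l => Sum.elim s ξ (τ k l))

theorem measurable_sumElim_comp (τ : Q → VS ⊕ VX) :
    Measurable fun p : (VX → ℝ) × (VS → ℝ) => fun l => Sum.elim p.2 p.1 (τ l) :=
  measurable_pi_lambda _ fun l => by cases τ l <;> simp <;> fun_prop

/-- Null sets stay null after substitution into a factor, and Fubini separates free and contracted
variables; hence contractions depend only on almost everywhere classes. -/
theorem ae_ae_sumElim_comp (hτ : ∀ k, Function.Injective (τ k)) {p : K → (Q → ℝ) → Prop}
    (h : ∀ k, ∀ᵐ x, p k x) :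
    ∀ᵐ ξ : VX → ℝ, ∀ᵐ s : VS → ℝ, ∀ k, p k (fun l => Sum.elim s ξ (τ k l)) := by
  refine Measure.ae_ae_of_ae_prod (p := fun z : (VX → ℝ) × (VS → ℝ) =>
    ∀ k, p k (fun l => Sum.elim z.2 z.1 (τ k l))) (ae_all_iff.2 fun k => ?_)
  have h1 : MeasurePreserving (fun z : (VX → ℝ) × (VS → ℝ) => (Sum.elim z.2 z.1 : VS ⊕ VX → ℝ))
      (volume.prod volume) volume := by
    have h2 := (volume_measurePreserving_sumPiEquivProdPi_symm
      (fun _ : VS ⊕ VX => ℝ)).comp (Measure.measurePreserving_swap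
        (μ := (volume : Measure (VX → ℝ))) (ν := (volume : Measure (VS → ℝ))))
    convert! h2 using 1
  classical
  exact ((quasiMeasurePreserving_comp (hτ k)).comp h1.quasiMeasurePreserving).ae (h k)

theorem generalContraction_congr_ae (hτ : ∀ k, Function.Injective (τ k))
    {g g' : K → (Q → ℝ) → ℝ} (h : ∀ k, g k =ᵐ[volume] g' k) :
    generalContraction τ g =ᵐ[volume] generalContraction τ g' := by
  filter_upwards [ae_ae_sumElim_comp hτ h] with ξ hξ
  refine integral_congr_ae ?_
  filter_upwards [hξ] with s hs
  exact Finset.prod_congr rfl fun k _ => hs k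

variable (hτ : ∀ k, Function.Injective (τ k))
    (hS : ∀ v, ∃ a b, a ≠ b ∧ ∀ k, Sum.inl v ∈ Set.range (τ k) ↔ k = a ∨ k = b)
    (hX : ∀ v, ∃ a, ∀ k, Sum.inr v ∈ Set.range (τ k) ↔ k = a)
    {g : K → (Q → ℝ) → ℝ} (hg : ∀ k, MemLp (g k) 2 volume)
include hτ hS hX hg

/-- The Cauchy-Schwarz bound, applied to absolute values of measurable versions of the factors,
shows that the integral of the absolute value is square integrable in `ξ`, thus finite almost
everywhere. It also dominates the contraction. -/
theorem ae_integrable_and_eLpNorm_generalContraction_le :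
    (∀ᵐ ξ : VX → ℝ, Integrable fun s : VS → ℝ => ∏ k, g k (fun l => Sum.elim s ξ (τ k l))) ∧
      AEStronglyMeasurable (generalContraction τ g) volume ∧
      eLpNorm (generalContraction τ g) 2 volume ≤ ∏ k, eLpNorm (g k) 2 volume := by
  classical
  let g' : K → (Q → ℝ) → ℝ := fun k => (hg k).1.mk
  have hg' : ∀ k, StronglyMeasurable (g' k) := fun k => (hg k).1.stronglyMeasurable_mk
  have hgg : ∀ k, g k =ᵐ[volume] g' k := fun k => (hg k).1.ae_eq_mk
  have hm : ∀ k, StronglyMeasurable fun p : (VX → ℝ) × (VS → ℝ) =>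
      g' k fun l => Sum.elim p.2 p.1 (τ k l) := fun k =>
    (hg' k).comp_measurable (measurable_sumElim_comp (τ k))
  have hmp : StronglyMeasurable fun p : (VX → ℝ) × (VS → ℝ) =>
      ∏ k, g' k fun l => Sum.elim p.2 p.1 (τ k l) :=
    Finset.stronglyMeasurable_fun_prod _ fun k _ => hm k
  have hcm : StronglyMeasurable (generalContraction τ g') := hmp.integral_prod_right'
  have hle : ∫⁻ ξ : VX → ℝ, (∫⁻ s : VS → ℝ,
      ‖∏ k, g' k (fun l => Sum.elim s ξ (τ k l))‖ₑ) ^ 2 ≤ (∏ k, eLpNorm (g k) 2 volume) ^ 2 := by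
    have := lintegral_contraction_sq_le τ hτ hS hX (fun k x => ‖g' k x‖ₑ)
      (fun k => (hg' k).measurable.enorm)
    simp only [← eLpNorm_two_pow_two, Finset.prod_pow, ← eLpNorm_congr_ae (hgg _)] at this
    convert! this using 5
    simp [enorm_eq_nnnorm, nnnorm_prod]
  have hfin : (∏ k, eLpNorm (g k) 2 volume) ^ 2 ≠ ∞ :=
    ENNReal.pow_ne_top (ENNReal.prod_ne_top fun k _ => (hg k).2.ne)
  have hae : ∀ᵐ ξ : VX → ℝ, (∫⁻ s : VS → ℝ,
      ‖∏ k, g' k (fun l => Sum.elim s ξ (τ k l))‖ₑ) ^ 2 < ∞ :=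
    ae_lt_top (hmp.measurable.enorm.lintegral_prod_right'.pow_const 2) (ne_top_of_le_ne_top hfin hle)
  refine ⟨?_, ⟨_, hcm, generalContraction_congr_ae hτ hgg⟩, ?_⟩
  · filter_upwards [hae, ae_ae_sumElim_comp hτ hgg] with ξ h1 h2
    have hi : Integrable fun s : VS → ℝ => ∏ k, g' k (fun l => Sum.elim s ξ (τ k l)) := by
      refine ⟨(hmp.comp_measurable measurable_prodMk_left).aestronglyMeasurable, ?_⟩
      rw [HasFiniteIntegral]
      simpa using h1
    refine hi.congr ?_
    filter_upwards [h2] with s hs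
    exact Finset.prod_congr rfl fun k _ => (hs k).symm
  · rw [eLpNorm_congr_ae (generalContraction_congr_ae hτ hgg),
      ← ENNReal.pow_le_pow_left_iff two_ne_zero, eLpNorm_two_pow_two]
    refine (lintegral_mono fun ξ => ?_).trans hle
    gcongr
    exact enorm_integral_le_lintegral_enorm _

theorem memLp_generalContraction : MemLp (generalContraction τ g) 2 volume := by
  obtain ⟨-, h1, h2⟩ := ae_integrable_and_eLpNorm_generalContraction_le hτ hS hX hg
  exact ⟨h1, h2.trans_lt (ENNReal.prod_lt_top fun k _ => (hg k).2)⟩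

/-- Additivity holds only almost everywhere, at those `ξ` where both integrands are integrable;
homogeneity, by contrast, holds everywhere. -/
theorem generalContraction_update_add [DecidableEq K] (j : K) {f f' : (Q → ℝ) → ℝ}
    (hf : MemLp f 2 volume) (hf' : MemLp f' 2 volume) :
    generalContraction τ (Function.update g j (f + f')) =ᵐ[volume]
      generalContraction τ (Function.update g j f) +
        generalContraction τ (Function.update g j f') := by
  have hu : ∀ f : (Q → ℝ) → ℝ, MemLp f 2 volume →
      ∀ k, MemLp (Function.update g j f k) 2 volume := fun f hf k => by
    by_cases h : k = j
    · subst h; simpa using hf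
    · simpa [h] using hg k
  filter_upwards [(ae_integrable_and_eLpNorm_generalContraction_le hτ hS hX (hu f hf)).1,
    (ae_integrable_and_eLpNorm_generalContraction_le hτ hS hX (hu f' hf')).1] with ξ h1 h2
  simp only [generalContraction, Pi.add_apply]
  rw [← integral_add h1 h2]
  refine integral_congr_ae (Eventually.of_forall fun s => ?_)
  have hr : ∀ f : (Q → ℝ) → ℝ, ∏ k ∈ Finset.univ.erase j, Function.update g j f k
      (fun l => Sum.elim s ξ (τ k l)) =
      ∏ k ∈ Finset.univ.erase j, g k (fun l => Sum.elim s ξ (τ k l)) := fun f =>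
    Finset.prod_congr rfl fun k hk => by rw [Function.update_of_ne (Finset.ne_of_mem_erase hk)]
  simp only [← Finset.mul_prod_erase Finset.univ _ (Finset.mem_univ j), hr,
    Function.update_self, Pi.add_apply, add_mul]

omit hτ hS hX hg in
theorem generalContraction_update_smul [DecidableEq K] (j : K) (c : ℝ) (f : (Q → ℝ) → ℝ) :
    generalContraction τ (Function.update g j (c • f)) =
      c • generalContraction τ (Function.update g j f) := by
  ext ξ
  simp only [generalContraction, Pi.smul_apply, smul_eq_mul]
  rw [← integral_const_mul]
  congr 1; ext s
  have hr : ∀ f : (Q → ℝ) → ℝ, ∏ k ∈ Finset.univ.erase j, Function.update g j f k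
      (fun l => Sum.elim s ξ (τ k l)) =
      ∏ k ∈ Finset.univ.erase j, g k (fun l => Sum.elim s ξ (τ k l)) := fun f =>
    Finset.prod_congr rfl fun k hk => by rw [Function.update_of_ne (Finset.ne_of_mem_erase hk)]
  simp only [← Finset.mul_prod_erase Finset.univ _ (Finset.mem_univ j), hr,
    Function.update_self, Pi.smul_apply, smul_eq_mul, mul_assoc]

end GeneralContraction

/-! ### The argument lists of the factors of a contraction -/

section Slots

variable {n q : ℕ} {α : MultiIndex n}

theorem u_self (α : MultiIndex n) (k : Fin n) : u α k k = 0 := by simp [u]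

/-- The pair formed by two distinct indices. -/
def pairOf {k j : Fin n} (h : k ≠ j) : Pair n :=
  if h' : k < j then ⟨(k, j), h'⟩ else ⟨(j, k), lt_of_le_of_ne (not_lt.1 h') h.symm⟩

theorem u_eq {k j : Fin n} (h : k ≠ j) : u α k j = α (pairOf h) := by
  rcases lt_or_gt_of_ne h with h' | h'
  · simp [u, pairOf, h']
  · simp [u, pairOf, h', h'.not_gt]

theorem ne_of_fin_u {k j : Fin n} (r : Fin (u α k j)) : k ≠ j := by
  rintro rfl
  rw [u_self] at r
  exact r.elim0

/-- The index of the variable `s^{k,j}_r`. -/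
def sIdx (k : Fin n) (x : (j : Fin n) × Fin (u α k j)) : SIndex α :=
  ⟨pairOf (ne_of_fin_u x.2), Fin.cast (u_eq (ne_of_fin_u x.2)) x.2⟩

theorem sVar_eq (s : SIndex α → ℝ) (k : Fin n) (x : (j : Fin n) × Fin (u α k j)) :
    sVar α s k x.1 x.2 = s (sIdx k x) := by
  obtain ⟨j, r⟩ := x
  have hne := ne_of_fin_u r
  rcases lt_or_gt_of_ne hne with h | h
  · simp only [sVar, h, dif_pos, sIdx]
    congr 1
    ext1
    · simp [pairOf, h]
    · simp only
      congr! 1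
  · simp only [sVar, h, h.not_gt, dif_pos, dif_neg, not_false_iff, sIdx]
    congr 1
    ext1
    · simp [pairOf, h.not_gt]
    · simp only
      congr! 1

theorem pairOf_injective {k j j' : Fin n} {h : k ≠ j} {h' : k ≠ j'} (e : pairOf h = pairOf h') :
    j = j' := by
  unfold pairOf at e
  split_ifs at e <;> simp only [Subtype.mk.injEq, Prod.mk.injEq] at e <;> omega

theorem mem_pairOf {k j : Fin n} (h : k ≠ j) : k = (pairOf h).1.1 ∨ k = (pairOf h).1.2 := by
  unfold pairOf
  split_ifs <;> simp

theorem sIdx_injective (k : Fin n) : Function.Injective (sIdx (α := α) k) := by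
  rintro ⟨j, r⟩ ⟨j', r'⟩ e
  simp only [sIdx, Sigma.mk.injEq] at e
  obtain rfl := pairOf_injective e.1
  have := eq_of_heq e.2
  simpa [Fin.ext_iff] using this

/-- The combinatorial input of the Cauchy-Schwarz bound: a variable attached to a pair is an
argument of the two factors of that pair and of no other. -/
theorem mem_range_sIdx {k : Fin n} {v : SIndex α} :
    v ∈ Set.range (sIdx (α := α) k) ↔ k = v.1.1.1 ∨ k = v.1.1.2 := by
  constructor
  · rintro ⟨x, rfl⟩
    exact mem_pairOf (ne_of_fin_u x.2)
  · obtain ⟨⟨⟨a, b⟩, hab⟩, r⟩ := v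
    simp only
    replace hab : a < b := hab
    rintro (rfl | rfl)
    · have h1 : pairOf hab.ne = ⟨(k, b), hab⟩ := by simp [pairOf, hab]
      have h2 : u α k b = α ⟨(k, b), hab⟩ := by rw [u_eq hab.ne, h1]
      refine ⟨⟨b, Fin.cast h2.symm r⟩, ?_⟩
      simp only [sIdx]
      ext1
      · exact h1
      · simp only
        refine (Fin.heq_ext_iff (by rw [h1])).2 ?_
        simp
    · have h1 : pairOf hab.ne' = ⟨(a, k), hab⟩ := by simp [pairOf, hab.not_gt]
      have h2 : u α k a = α ⟨(a, k), hab⟩ := by rw [u_eq hab.ne', h1]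
      refine ⟨⟨a, Fin.cast h2.symm r⟩, ?_⟩
      simp only [sIdx]
      ext1
      · exact h1
      · simp only
        refine (Fin.heq_ext_iff (by rw [h1])).2 ?_
        simp

theorem card_block_eq (hα : α ∈ A n q) (k : Fin n) : ∑ j, u α k j + beta0 q α k = q := by
  rw [sum_u, beta0, Nat.add_sub_cancel' ((mem_A α).1 hα k)]

/-- The positions in the argument list of the `k`-th factor: contracted ones, and free ones. -/
def blockEquiv (hα : α ∈ A n q) (k : Fin n) :
    ((j : Fin n) × Fin (u α k j)) ⊕ Fin (beta0 q α k) ≃ Fin q :=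
  ((Equiv.sumCongr finSigmaFinEquiv (Equiv.refl _)).trans finSumFinEquiv).trans
    (finCongr (card_block_eq hα k))

/-- The index of the `i`-th free variable of the `k`-th factor. -/
def freeIdx (q : ℕ) (α : MultiIndex n) (k : Fin n) (i : Fin (beta0 q α k)) : Fin (order q α) :=
  finSigmaFinEquiv ⟨k, i⟩

/-- The factor in which a free variable occurs. -/
def factorOf (q : ℕ) (α : MultiIndex n) (v : Fin (order q α)) : Fin n :=
  (finSigmaFinEquiv (n := beta0 q α).symm v).1

theorem freeIdx_injective (k : Fin n) : Function.Injective (freeIdx q α k) := by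
  intro i j h
  simpa using finSigmaFinEquiv.injective h

theorem mem_range_freeIdx {k : Fin n} {v : Fin (order q α)} :
    v ∈ Set.range (freeIdx q α k) ↔ k = factorOf q α v := by
  obtain ⟨⟨k', i⟩, rfl⟩ := (finSigmaFinEquiv (n := beta0 q α)).surjective v
  have hk : factorOf q α (finSigmaFinEquiv ⟨k', i⟩ : Fin (order q α)) = k' :=
    congrArg Sigma.fst (finSigmaFinEquiv.symm_apply_apply _)
  rw [hk]
  constructor
  · rintro ⟨i, h⟩
    exact congrArg Sigma.fst (finSigmaFinEquiv.injective h)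
  · rintro rfl
    exact ⟨i, rfl⟩

/-- The variables of the `k`-th factor. -/
def blockIdx (q : ℕ) (α : MultiIndex n) (k : Fin n) :
    ((j : Fin n) × Fin (u α k j)) ⊕ Fin (beta0 q α k) → SIndex α ⊕ Fin (order q α) :=
  Sum.map (sIdx k) (freeIdx q α k)

/-- The variable at the `l`-th position in the argument list of the `k`-th factor. -/
def slotIdx (hα : α ∈ A n q) (k : Fin n) (l : Fin q) : SIndex α ⊕ Fin (order q α) :=
  blockIdx q α k ((blockEquiv hα k).symm l)

/-- Turns the numbered argument list into substitution along an index map, the form required by the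
results on `generalContraction`. -/
theorem slots_eq (hα : α ∈ A n q) (s : SIndex α → ℝ) (ξ : Fin (order q α) → ℝ) (k : Fin n) :
    slots q α s ξ k = fun l => Sum.elim s ξ (slotIdx hα k l) := by
  ext l
  obtain ⟨x, rfl⟩ := (blockEquiv hα k).surjective l
  rw [slotIdx, Equiv.symm_apply_apply]
  rcases x with x | i
  · have hv : ((blockEquiv hα k (Sum.inl x) : Fin q) : ℕ) = finSigmaFinEquiv x := by
      simp [blockEquiv]
    have hlt : ((blockEquiv hα k (Sum.inl x) : Fin q) : ℕ) < ∑ j, u α k j := by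
      rw [hv]; exact (finSigmaFinEquiv x).2
    have he : (⟨_, hlt⟩ : Fin (∑ j, u α k j)) = finSigmaFinEquiv x := Fin.ext hv
    simp only [slots, hlt, dif_pos, he, Equiv.symm_apply_apply, sVar_eq]
    rfl
  · have hv : ((blockEquiv hα k (Sum.inr i) : Fin q) : ℕ) = ∑ j, u α k j + i := by
      simp [blockEquiv]
    have hlt : ¬ ((blockEquiv hα k (Sum.inr i) : Fin q) : ℕ) < ∑ j, u α k j := by
      rw [hv]; omega
    simp only [slots, hlt, dif_neg, not_false_iff, blockIdx, Sum.map_inr, Sum.elim_inr]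
    congr 3
    ext
    simp [hv]

theorem slotIdx_injective (hα : α ∈ A n q) (k : Fin n) : Function.Injective (slotIdx hα k) := by
  refine Function.Injective.comp ?_ (blockEquiv hα k).symm.injective
  exact Sum.map_injective.2 ⟨sIdx_injective k, freeIdx_injective k⟩

theorem inl_mem_range_slotIdx (hα : α ∈ A n q) (k : Fin n) (v : SIndex α) :
    Sum.inl v ∈ Set.range (slotIdx hα k) ↔ k = v.1.1.1 ∨ k = v.1.1.2 := by
  rw [← mem_range_sIdx]
  have : slotIdx hα k = blockIdx q α k ∘ (blockEquiv hα k).symm := rfl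
  rw [this, (blockEquiv hα k).symm.surjective.range_comp]
  simp [blockIdx]

theorem inr_mem_range_slotIdx (hα : α ∈ A n q) (k : Fin n) (v : Fin (order q α)) :
    Sum.inr v ∈ Set.range (slotIdx hα k) ↔
      k = factorOf q α v := by
  rw [← mem_range_freeIdx]
  have : slotIdx hα k = blockIdx q α k ∘ (blockEquiv hα k).symm := rfl
  rw [this, (blockEquiv hα k).symm.surjective.range_comp]
  simp [blockIdx]

theorem contractionIntegrand_eq (hα : α ∈ A n q) (h : Fin n → (Fin q → ℝ) → ℝ)
    (ξ : Fin (order q α) → ℝ) :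
    contractionIntegrand α h ξ = fun s => ∏ k, h k (fun l => Sum.elim s ξ (slotIdx hα k l)) := by
  ext s
  simp only [contractionIntegrand, slots_eq hα]

theorem contraction_eq (hα : α ∈ A n q) (h : Fin n → (Fin q → ℝ) → ℝ) :
    contraction α h = generalContraction (slotIdx hα) h := by
  ext ξ
  simp only [contraction, contractionIntegrand_eq hα, generalContraction]

theorem exists_pair_slotIdx (hα : α ∈ A n q) (v : SIndex α) :
    ∃ a b, a ≠ b ∧ ∀ k, Sum.inl v ∈ Set.range (slotIdx hα k) ↔ k = a ∨ k = b :=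
  ⟨_, _, v.1.2.ne, fun k => inl_mem_range_slotIdx hα k v⟩

theorem exists_single_slotIdx (hα : α ∈ A n q) (v : Fin (order q α)) :
    ∃ a, ∀ k, Sum.inr v ∈ Set.range (slotIdx hα k) ↔ k = a :=
  ⟨_, fun k => inr_mem_range_slotIdx hα k v⟩

theorem ae_integrable_contractionIntegrand (hα : α ∈ A n q) {h : Fin n → (Fin q → ℝ) → ℝ}
    (hh : ∀ k, MemLp (h k) 2 volume) :
    ∀ᵐ ξ : Fin (order q α) → ℝ, Integrable (contractionIntegrand α h ξ) := by
  simp only [contractionIntegrand_eq hα]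
  exact (ae_integrable_and_eLpNorm_generalContraction_le (slotIdx_injective hα)
    (exists_pair_slotIdx hα) (exists_single_slotIdx hα) hh).1

theorem memLp_contraction (hα : α ∈ A n q) {h : Fin n → (Fin q → ℝ) → ℝ}
    (hh : ∀ k, MemLp (h k) 2 volume) : MemLp (contraction α h) 2 volume := by
  rw [contraction_eq hα]
  exact memLp_generalContraction (slotIdx_injective hα)
    (exists_pair_slotIdx hα) (exists_single_slotIdx hα) hh

theorem eLpNorm_contraction_le (hα : α ∈ A n q) {h : Fin n → (Fin q → ℝ) → ℝ}
    (hh : ∀ k, MemLp (h k) 2 volume) :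
    eLpNorm (contraction α h) 2 volume ≤ ∏ k, eLpNorm (h k) 2 volume := by
  rw [contraction_eq hα]
  exact (ae_integrable_and_eLpNorm_generalContraction_le (slotIdx_injective hα)
    (exists_pair_slotIdx hα) (exists_single_slotIdx hα) hh).2.2

theorem contraction_update_add (hα : α ∈ A n q) {h : Fin n → (Fin q → ℝ) → ℝ}
    (hh : ∀ k, MemLp (h k) 2 volume) (j : Fin n) {f f' : (Fin q → ℝ) → ℝ}
    (hf : MemLp f 2 volume) (hf' : MemLp f' 2 volume) :
    contraction α (Function.update h j (f + f')) =ᵐ[volume]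
      contraction α (Function.update h j f) + contraction α (Function.update h j f') := by
  simp only [contraction_eq hα]
  exact generalContraction_update_add (slotIdx_injective hα)
    (exists_pair_slotIdx hα) (exists_single_slotIdx hα) hh j hf hf'

theorem contraction_update_smul (hα : α ∈ A n q) (h : Fin n → (Fin q → ℝ) → ℝ)
    (j : Fin n) (c : ℝ) (f : (Fin q → ℝ) → ℝ) :
    contraction α (Function.update h j (c • f)) =
      c • contraction α (Function.update h j f) := by
  simp only [contraction_eq hα]
  exact generalContraction_update_smul j c f

/-- The contraction of tensor powers. -/
theorem contraction_tensor (hα : α ∈ A n q) (g : Fin n → ℝ → ℝ) (ξ : Fin (order q α) → ℝ) :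
    contraction α (fun k (x : Fin q → ℝ) => ∏ l, g k (x l)) ξ =
      (∏ e : Pair n, (∫ t, g e.1.1 t * g e.1.2 t) ^ α e) *
        ∏ i, g (factorOf q α i) (ξ i) := by
  have h1 : ∀ (s : SIndex α → ℝ) k, ∏ l, g k (Sum.elim s ξ (slotIdx hα k l)) =
      (∏ v : SIndex α, if k = v.1.1.1 ∨ k = v.1.1.2 then g k (s v) else 1) *
        ∏ i, if k = (factorOf q α i) then g k (ξ i) else 1 := by
    intro s k
    -- No variable occurs twice in one factor, so a product over positions becomes a product over
    -- variables, with `1` for the absent ones.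
    rw [← Finset.prod_image (s := Finset.univ) (g := slotIdx hα k)
      (f := fun v => g k (Sum.elim s ξ v)) fun a _ b _ h => slotIdx_injective hα k h]
    have : (Finset.univ.image (slotIdx hα k)) =
        Finset.univ.filter fun v => v ∈ Set.range (slotIdx hα k) := by ext; simp
    rw [this, Finset.prod_filter, Fintype.prod_sum_type]
    simp only [inl_mem_range_slotIdx, inr_mem_range_slotIdx, Sum.elim_inl, Sum.elim_inr]
  have h2 : contractionIntegrand α (fun k (x : Fin q → ℝ) => ∏ l, g k (x l)) ξ = fun s =>
      (∏ v : SIndex α, g v.1.1.1 (s v) * g v.1.1.2 (s v)) *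
        ∏ i, g (factorOf q α i) (ξ i) := by
    rw [contractionIntegrand_eq hα]
    ext s
    simp only [h1]
    rw [Finset.prod_mul_distrib, Finset.prod_comm, Finset.prod_comm (s := Finset.univ (α := Fin n))]
    congr 1
    · refine Finset.prod_congr rfl fun v _ => ?_
      rw [← Finset.prod_filter]
      have : (Finset.univ.filter fun k => k = v.1.1.1 ∨ k = v.1.1.2) = {v.1.1.1, v.1.1.2} := by
        ext k; simp
      rw [this, Finset.prod_pair v.1.2.ne]
    · refine Finset.prod_congr rfl fun i _ => ?_
      rw [Finset.prod_ite_eq' Finset.univ]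
      simp
  rw [contraction, h2, integral_mul_const]
  congr 1
  rw [integral_fintype_prod_volume_eq_prod fun (v : SIndex α) t => g v.1.1.1 t * g v.1.1.2 t,
    Fintype.prod_sigma]
  simp

end Slots

/-! ### The product formula -/

section ProductFormula

variable {Ω : Type*} [MeasurableSpace Ω] {P : Measure Ω} [IsProbabilityMeasure P] {B : ℝ → Ω → ℝ}
  (hB : IsTwoSidedBrownianMotion B P) {n q : ℕ}

theorem content_factorOf (α : MultiIndex n) : content (factorOf q α) = beta0Exp q α := by
  ext k
  have e : Fin (beta0 q α k) ≃ {v // factorOf q α v = k} := Equiv.ofBijective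
    (fun i => ⟨freeIdx q α k i, (mem_range_freeIdx.1 ⟨i, rfl⟩).symm⟩)
    ⟨fun i j h => freeIdx_injective k (congrArg Subtype.val h), fun v => by
      obtain ⟨i, hi⟩ := mem_range_freeIdx.2 v.2.symm
      exact ⟨i, Subtype.ext hi⟩⟩
  rw [content_apply, ← Fintype.card_congr e, Fintype.card_fin]
  rfl

/-- The right hand side of the product formula. -/
def expansion (B : ℝ → Ω → ℝ) (P : Measure Ω) (h : Fin n → (Fin q → ℝ) → ℝ) (ω : Ω) : ℝ :=
  ∑ α ∈ A n q, C q α * multipleIntegral B P (order q α) (contraction α h) ω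

theorem expansion_eq_sum (h : Fin n → (Fin q → ℝ) → ℝ) : expansion B P h =
    ∑ α ∈ A n q, C q α • multipleIntegral B P (order q α) (contraction α h) := by
  ext ω
  simp [expansion]

/-- The product formula holds for the family `h`. -/
def HasProductFormula (B : ℝ → Ω → ℝ) (P : Measure Ω) (h : Fin n → (Fin q → ℝ) → ℝ) : Prop :=
  (fun ω => ∏ k, multipleIntegral B P q (h k) ω) =ᵐ[P] expansion B P h

include hB

theorem isMultipleIntegral_tensor (φ : ℝ →₀ ℝ) :
    IsMultipleIntegral B P q (powPair B q φ).1 (powPair B q φ).2 := by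
  have h : powPair B q φ ∈ chaosSpan B q := Submodule.subset_span ⟨φ, rfl⟩
  refine isMultipleIntegral_of_mem_chaosSpan hB (memLp_of_mem_chaosSpan hB h).1 ?_
  rwa [symmetrization_of_mem_chaosSpan h]

/-- The contraction is a constant times the tensor product along the word `factorOf q α`, whose
content is `β⁰`; its integral is therefore a Wick product of that multidegree. -/
theorem isMultipleIntegral_contraction_tensor {α : MultiIndex n} (hα : α ∈ A n q)
    (φ : Fin n → ℝ →₀ ℝ) :
    IsMultipleIntegral B P (order q α) (contraction α fun k => (powPair B q (φ k)).1)
      (fun ω => (∏ e : Pair n, stepInner (φ e.1.1) (φ e.1.2) ^ α e) *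
        ((∏ k, ((beta0 q α k).factorial : ℝ)) *
          (wickPoly (fun k => wiener B (φ k) ω) (fun k l => stepInner (φ k) (φ l))
            (order q α)).coeff (beta0Exp q α))) := by
  have hc : (contraction α fun k => (powPair B q (φ k)).1) =
      (∏ e : Pair n, stepInner (φ e.1.1) (φ e.1.2) ^ α e) •
        fun ξ => ∏ i, stepFun (φ (factorOf q α i)) (ξ i) := by
    ext ξ
    exact contraction_tensor hα (fun k => stepFun (φ k)) ξ
  rw [hc]
  have hmem := symmetrization_tensor_mem_chaosSpan (B := B) φ (factorOf q α)
  rw [content_factorOf] at hmem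
  exact (isMultipleIntegral_of_mem_chaosSpan hB
    (memLp_tensor fun i => memLp_stepFun (φ (factorOf q α i))) hmem).const_smul hB _

/-- This is `prod_herm` multiplied by `q! ^ n`. The factorials of `β⁰` in `C q α` cancel those in
the integral of the contraction, and those of `α` come from the exponential of the pairings. -/
theorem hasProductFormula_tensor (φ : Fin n → ℝ →₀ ℝ) :
    HasProductFormula B P fun k => (powPair B q (φ k)).1 := by
  have h1 : ∀ k, multipleIntegral B P q (powPair B q (φ k)).1 =ᵐ[P] (powPair B q (φ k)).2 :=
    fun k => (isMultipleIntegral_tensor hB (φ k)).multipleIntegral_ae_eq hB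
  have h2 : ∀ α : A n q, _ := fun α =>
    (isMultipleIntegral_contraction_tensor hB α.2 φ).multipleIntegral_ae_eq hB
  filter_upwards [ae_all_iff.2 h1, ae_all_iff.2 h2] with ω h1 h2
  simp only [h1]
  simp only [expansion, powPair, Finset.prod_mul_distrib, Finset.prod_const, Finset.card_univ,
    Fintype.card_fin]
  rw [prod_herm q (fun k => wiener B (φ k) ω) (fun k l => stepInner (φ k) (φ l))
    fun k l => stepInner_comm _ _, Finset.mul_sum]
  refine Finset.sum_congr rfl fun α hα => ?_
  have := h2 ⟨α, hα⟩
  simp only [powPair] at this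
  rw [this]
  have hb : (∏ k, ((beta0 q α k).factorial : ℝ)) ≠ 0 :=
    Finset.prod_ne_zero_iff.2 fun k _ => by positivity
  have ha : (∏ e, ((α e).factorial : ℝ)) ≠ 0 :=
    Finset.prod_ne_zero_iff.2 fun k _ => by positivity
  simp only [C, Finset.prod_div_distrib]
  field_simp

theorem memLp_expansion {h : Fin n → (Fin q → ℝ) → ℝ} (hh : ∀ k, MemLp (h k) 2 volume) :
    MemLp (expansion B P h) 2 P := by
  rw [expansion_eq_sum]
  exact memLp_finsetSum' _ fun α hα =>
    (isMultipleIntegral_multipleIntegral hB (memLp_contraction hα hh)).2.1.const_smul _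

theorem eLpNorm_expansion_le {h : Fin n → (Fin q → ℝ) → ℝ} (hh : ∀ k, MemLp (h k) 2 volume) :
    eLpNorm (expansion B P h) 2 P ≤
      (∑ α ∈ A n q, ‖C q α‖ₑ * ENNReal.ofReal √(order q α).factorial) *
        ∏ k, eLpNorm (h k) 2 volume := by
  have hI := fun α (hα : α ∈ A n q) =>
    isMultipleIntegral_multipleIntegral hB (memLp_contraction hα hh)
  rw [expansion_eq_sum, Finset.sum_mul]
  refine (eLpNorm_sum_le (fun α hα => (hI α hα).2.1.1.const_smul _) one_le_two).trans
    (Finset.sum_le_sum fun α hα => ?_)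
  rw [eLpNorm_const_smul, mul_assoc]
  gcongr
  exact ((hI α hα).eLpNorm_le hB).trans (by gcongr; exact eLpNorm_contraction_le hα hh)

omit hB [IsProbabilityMeasure P] in
theorem memLp_update {h : Fin n → (Fin q → ℝ) → ℝ} (hh : ∀ k, MemLp (h k) 2 volume) (j : Fin n)
    {f : (Fin q → ℝ) → ℝ} (hf : MemLp f 2 volume) (k : Fin n) :
    MemLp (Function.update h j f k) 2 volume := by
  by_cases hk : k = j
  · subst hk; simpa using hf
  · simpa [hk] using hh k

/-! ### Dependence of the two sides on a single factor. -/

section Slot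

variable {h : Fin n → (Fin q → ℝ) → ℝ} (hh : ∀ k, MemLp (h k) 2 volume) (j : Fin n)
include hh

theorem expansion_update_add {f g : (Fin q → ℝ) → ℝ} (hf : MemLp f 2 volume)
    (hg : MemLp g 2 volume) :
    expansion B P (Function.update h j (f + g)) =ᵐ[P]
      expansion B P (Function.update h j f) + expansion B P (Function.update h j g) := by
  have h1 : ∀ α : A n q, _ := fun α =>
    ((((isMultipleIntegral_multipleIntegral hB
      (memLp_contraction α.2 (memLp_update hh j hf))).add hB
      (isMultipleIntegral_multipleIntegral hB
        (memLp_contraction α.2 (memLp_update hh j hg)))).congr_left hB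
      (contraction_update_add α.2 hh j hf hg).symm).multipleIntegral_ae_eq hB)
  filter_upwards [ae_all_iff.2 h1] with ω h1
  simp only [expansion, Pi.add_apply, ← Finset.sum_add_distrib, ← mul_add]
  exact Finset.sum_congr rfl fun α hα => by rw [h1 ⟨α, hα⟩]; rfl

theorem expansion_update_smul (c : ℝ) {f : (Fin q → ℝ) → ℝ} (hf : MemLp f 2 volume) :
    expansion B P (Function.update h j (c • f)) =ᵐ[P]
      c • expansion B P (Function.update h j f) := by
  have h1 : ∀ α : A n q, multipleIntegral B P (order q α.1)
      (contraction α.1 (Function.update h j (c • f))) =ᵐ[P]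
      c • multipleIntegral B P (order q α.1) (contraction α.1 (Function.update h j f)) := fun α => by
    rw [contraction_update_smul α.2]
    exact ((isMultipleIntegral_multipleIntegral hB
      (memLp_contraction α.2 (memLp_update hh j hf))).const_smul hB c).multipleIntegral_ae_eq hB
  filter_upwards [ae_all_iff.2 h1] with ω h1
  simp only [expansion, Pi.smul_apply, smul_eq_mul, Finset.mul_sum]
  refine Finset.sum_congr rfl fun α hα => ?_
  rw [h1 ⟨α, hα⟩, Pi.smul_apply, smul_eq_mul, mul_left_comm]

omit hB hh [IsProbabilityMeasure P] in
theorem hasProductFormula_update_iff (f : (Fin q → ℝ) → ℝ) :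
    HasProductFormula B P (Function.update h j f) ↔
      (fun ω => multipleIntegral B P q f ω *
        ∏ k ∈ Finset.univ.erase j, multipleIntegral B P q (h k) ω) =ᵐ[P]
        expansion B P (Function.update h j f) := by
  have : (fun ω => ∏ k, multipleIntegral B P q (Function.update h j f k) ω) =
      fun ω => multipleIntegral B P q f ω *
        ∏ k ∈ Finset.univ.erase j, multipleIntegral B P q (h k) ω := by
    ext ω
    rw [← Finset.mul_prod_erase Finset.univ _ (Finset.mem_univ j), Function.update_self]
    congr 1
    exact Finset.prod_congr rfl fun k hk => by
      rw [Function.update_of_ne (Finset.ne_of_mem_erase hk)]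
  rw [HasProductFormula, this]

theorem HasProductFormula.update_add {f g : (Fin q → ℝ) → ℝ} (hf : MemLp f 2 volume)
    (hg : MemLp g 2 volume) (h1 : HasProductFormula B P (Function.update h j f))
    (h2 : HasProductFormula B P (Function.update h j g)) :
    HasProductFormula B P (Function.update h j (f + g)) := by
  rw [hasProductFormula_update_iff] at *
  filter_upwards [h1, h2, expansion_update_add hB hh j hf hg,
    ((isMultipleIntegral_multipleIntegral hB hf).add hB
      (isMultipleIntegral_multipleIntegral hB hg)).multipleIntegral_ae_eq hB] with ω h1 h2 h3 h4
  rw [h3, h4, Pi.add_apply, Pi.add_apply, add_mul, h1, h2]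

theorem HasProductFormula.update_smul (c : ℝ) {f : (Fin q → ℝ) → ℝ} (hf : MemLp f 2 volume)
    (h1 : HasProductFormula B P (Function.update h j f)) :
    HasProductFormula B P (Function.update h j (c • f)) := by
  rw [hasProductFormula_update_iff] at *
  filter_upwards [h1, expansion_update_smul hB hh j c hf,
    ((isMultipleIntegral_multipleIntegral hB hf).const_smul hB c).multipleIntegral_ae_eq hB]
    with ω h1 h3 h4
  rw [h3, h4, Pi.smul_apply, Pi.smul_apply, smul_eq_mul, smul_eq_mul, mul_assoc, h1]

theorem HasProductFormula.update_of_mem_chaosSpan {F : ((Fin q → ℝ) → ℝ) × (Ω → ℝ)}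
    (hF : F ∈ chaosSpan B q)
    (hpow : ∀ φ, HasProductFormula B P (Function.update h j (powPair B q φ).1)) :
    HasProductFormula B P (Function.update h j F.1) := by
  induction hF using Submodule.span_induction with
  | mem x hx =>
    obtain ⟨φ, rfl⟩ := hx
    exact hpow φ
  | zero =>
    have := (hpow 0).update_smul hB hh j 0 (isMultipleIntegral_tensor hB 0).1
    rwa [zero_smul] at this
  | add x y hx hy h1 h2 =>
    exact h1.update_add hB hh j (memLp_of_mem_chaosSpan hB hx).1 (memLp_of_mem_chaosSpan hB hy).1 h2
  | smul c x hx h1 => exact h1.update_smul hB hh j c (memLp_of_mem_chaosSpan hB hx).1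

omit hh in
theorem tendsto_multipleIntegral {f : (Fin q → ℝ) → ℝ} {g : ℕ → (Fin q → ℝ) → ℝ}
    (hf : MemLp f 2 volume) (hg : ∀ N, MemLp (g N) 2 volume)
    (hlim : Tendsto (fun N => eLpNorm (g N - f) 2 volume) atTop (𝓝 0)) :
    Tendsto (fun N => eLpNorm (multipleIntegral B P q (g N) - multipleIntegral B P q f) 2 P)
      atTop (𝓝 0) := by
  have hI := isMultipleIntegral_multipleIntegral hB hf
  have hJ := fun N => isMultipleIntegral_multipleIntegral hB (hg N)
  have hle : ∀ N, eLpNorm (multipleIntegral B P q (g N) - multipleIntegral B P q f) 2 P ≤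
      ENNReal.ofReal √q.factorial * eLpNorm (g N - f) 2 volume := fun N => by
    have := ((hJ N).add hB (hI.const_smul hB (-1))).eLpNorm_le hB
    simpa only [neg_one_smul, ← sub_eq_add_neg] using this
  have h0 := ENNReal.Tendsto.const_mul hlim (a := ENNReal.ofReal √q.factorial)
    (Or.inr ENNReal.ofReal_ne_top)
  rw [mul_zero] at h0
  exact tendsto_of_tendsto_of_tendsto_of_le_of_le tendsto_const_nhds h0 (fun _ => zero_le) hle

theorem tendsto_expansion {f : (Fin q → ℝ) → ℝ} {g : ℕ → (Fin q → ℝ) → ℝ}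
    (hf : MemLp f 2 volume) (hg : ∀ N, MemLp (g N) 2 volume)
    (hlim : Tendsto (fun N => eLpNorm (g N - f) 2 volume) atTop (𝓝 0)) :
    Tendsto (fun N => eLpNorm (expansion B P (Function.update h j (g N)) -
      expansion B P (Function.update h j f)) 2 P) atTop (𝓝 0) := by
  set K : ENNReal := (∑ α ∈ A n q, ‖C q α‖ₑ * ENNReal.ofReal √(order q α).factorial) *
    ∏ k ∈ Finset.univ.erase j, eLpNorm (h k) 2 volume with hK
  have hKtop : K ≠ ⊤ := ENNReal.mul_ne_top
    (ENNReal.sum_ne_top.2 fun α _ => ENNReal.mul_ne_top enorm_ne_top ENNReal.ofReal_ne_top)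
    (ENNReal.prod_ne_top fun k _ => (hh k).2.ne)
  have hle : ∀ N, eLpNorm (expansion B P (Function.update h j (g N)) -
      expansion B P (Function.update h j f)) 2 P ≤ K * eLpNorm (g N - f) 2 volume := fun N => by
    have hd : MemLp (g N - f) 2 volume := (hg N).sub hf
    have e : expansion B P (Function.update h j (g N)) - expansion B P (Function.update h j f)
        =ᵐ[P] expansion B P (Function.update h j (g N - f)) := by
      have := expansion_update_add hB hh j hd hf
      rw [sub_add_cancel] at this
      filter_upwards [this] with ω hω
      rw [Pi.sub_apply, hω, Pi.add_apply, add_sub_cancel_right]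
    rw [eLpNorm_congr_ae e]
    refine (eLpNorm_expansion_le hB (memLp_update hh j hd)).trans (le_of_eq ?_)
    rw [← Finset.mul_prod_erase Finset.univ _ (Finset.mem_univ j), Function.update_self,
      Finset.prod_congr rfl fun k hk => by
        rw [Function.update_of_ne (Finset.ne_of_mem_erase hk)], hK]
    ring
  have h0 := ENNReal.Tendsto.const_mul hlim (a := K) (Or.inr hKtop)
  rw [mul_zero] at h0
  exact tendsto_of_tendsto_of_tendsto_of_le_of_le tendsto_const_nhds h0 (fun _ => zero_le) hle

/-- The fixed factors are only known to be square integrable, so the products need not converge in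
`L²`. Almost sure convergence along a subsequence suffices, since multiplication by a fixed finite
number is continuous. -/
theorem HasProductFormula.update_of_tendsto {f : (Fin q → ℝ) → ℝ} {g : ℕ → (Fin q → ℝ) → ℝ}
    (hf : MemLp f 2 volume) (hg : ∀ N, MemLp (g N) 2 volume)
    (hlim : Tendsto (fun N => eLpNorm (g N - f) 2 volume) atTop (𝓝 0))
    (hP : ∀ N, HasProductFormula B P (Function.update h j (g N))) :
    HasProductFormula B P (Function.update h j f) := by
  simp only [hasProductFormula_update_iff] at *
  have hJ := fun N => (isMultipleIntegral_multipleIntegral hB (hg N)).2.1.1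
  obtain ⟨ns, hns, h1⟩ := (tendstoInMeasure_of_tendsto_eLpNorm two_ne_zero hJ
    (isMultipleIntegral_multipleIntegral hB hf).2.1.1
    (tendsto_multipleIntegral hB hf hg hlim)).exists_seq_tendsto_ae
  -- The second subsequence is extracted from the first, so that both sides converge along the same
  -- indices.
  obtain ⟨ms, hms, h2⟩ := (tendstoInMeasure_of_tendsto_eLpNorm two_ne_zero
    (fun N => (memLp_expansion hB (memLp_update hh j (hg (ns N)))).1)
    (memLp_expansion hB (memLp_update hh j hf)).1
    ((tendsto_expansion hB hh j hf hg hlim).comp hns.tendsto_atTop)).exists_seq_tendsto_ae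
  filter_upwards [h1, h2, ae_all_iff.2 hP] with ω h1 h2 hP
  refine tendsto_nhds_unique ?_ h2
  simp only [← hP]
  exact (h1.comp hms.tendsto_atTop).mul_const _

/-- Symmetry is essential here: functions in `chaosSpan` are symmetric, so their limits reach `f`
only because `f` agrees almost everywhere with its symmetrization. -/
theorem HasProductFormula.update_of_memSymL2 {f : (Fin q → ℝ) → ℝ} (hf : MemSymL2 f)
    (hpow : ∀ φ, HasProductFormula B P (Function.update h j (powPair B q φ).1)) :
    HasProductFormula B P (Function.update h j f) := by
  obtain ⟨e, -, he⟩ := exists_tendsto_symmetrization hf.1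
  have hmem := fun N => offDiagStep_mem_chaosSpan (B := B) (e N)
  refine update_of_tendsto hB hh j hf.1 (fun N => (memLp_of_mem_chaosSpan hB (hmem N)).1) ?_
    fun N => update_of_mem_chaosSpan hB hh j (hmem N) hpow
  exact he.congr fun N => eLpNorm_congr_ae (EventuallyEq.rfl.sub (symmetrization_ae_eq hf.2))

end Slot

theorem hasProductFormula {h : Fin n → (Fin q → ℝ) → ℝ} (hh : ∀ k, MemSymL2 (h k)) :
    HasProductFormula B P h := by
  -- Induction on the set of factors that are arbitrary, the others being tensor powers of step
  -- functions. Enlarging the set by `j` uses density in the `j`-th factor alone.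
  suffices H : ∀ (s : Finset (Fin n)) (h : Fin n → (Fin q → ℝ) → ℝ),
      (∀ k ∈ s, MemSymL2 (h k)) → (∀ k ∉ s, ∃ φ, h k = (powPair B q φ).1) →
        HasProductFormula B P h from H Finset.univ h (fun k _ => hh k) (by simp)
  intro s
  induction s using Finset.induction_on with
  | empty =>
    intro h _ h2
    choose φ hφ using fun k => h2 k (Finset.notMem_empty k)
    rw [funext hφ]
    exact hasProductFormula_tensor hB φ
  | insert j s hj ih =>
    intro h h1 h2
    have hL : ∀ k, MemLp (h k) 2 volume := fun k => by
      by_cases hk : k ∈ insert j s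
      · exact (h1 k hk).1
      · obtain ⟨φ, hφ⟩ := h2 k hk
        rw [hφ]
        exact (isMultipleIntegral_tensor hB φ).1
    rw [← Function.update_eq_self j h]
    refine HasProductFormula.update_of_memSymL2 hB hL j (h1 j (Finset.mem_insert_self j s))
      fun φ => ih _ (fun k hk => ?_) fun k hk => ?_
    · rw [Function.update_of_ne (by rintro rfl; exact hj hk)]
      exact h1 k (Finset.mem_insert_of_mem hk)
    · by_cases hkj : k = j
      · subst hkj
        exact ⟨φ, Function.update_self _ _ _⟩
      · rw [Function.update_of_ne hkj]
        exact h2 k (by simp [hkj, hk])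

end ProductFormula

end

end WienerChaos

theorem lemma2p1 {Ω : Type*} [MeasurableSpace Ω] (P : MeasureTheory.Measure Ω)
    [MeasureTheory.IsProbabilityMeasure P] (B : ℝ → Ω → ℝ)
    (hB : WienerChaos.IsTwoSidedBrownianMotion B P)
    (n q : ℕ) (hn : 2 ≤ n) (hq : 2 ≤ q)
    (h : Fin n → (Fin q → ℝ) → ℝ) (hh : ∀ k, WienerChaos.MemSymL2 (h k)) :
    -- all the objects in the formula are well defined
    (∀ k, WienerChaos.IsMultipleIntegral B P q (h k)
      (WienerChaos.multipleIntegral B P q (h k))) ∧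
    (∀ α ∈ WienerChaos.A n q,
      (∀ᵐ ξ : Fin (WienerChaos.order q α) → ℝ,
        Integrable (WienerChaos.contractionIntegrand α h ξ)) ∧
      MemLp (WienerChaos.contraction α h) 2 volume ∧
      WienerChaos.IsMultipleIntegral B P (WienerChaos.order q α) (WienerChaos.contraction α h)
        (WienerChaos.multipleIntegral B P (WienerChaos.order q α)
          (WienerChaos.contraction α h))) ∧
    -- the product formula
    (fun ω => ∏ k, WienerChaos.multipleIntegral B P q (h k) ω) =ᵐ[P]
      fun ω => ∑ α ∈ WienerChaos.A n q,
        WienerChaos.C q α *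
          WienerChaos.multipleIntegral B P (WienerChaos.order q α)
            (WienerChaos.contraction α h) ω := by
  have hL := fun k => (hh k).1
  refine ⟨fun k => WienerChaos.isMultipleIntegral_multipleIntegral hB (hL k), fun α hα => ?_,
    WienerChaos.hasProductFormula hB hh⟩
  have hc := WienerChaos.memLp_contraction hα hL
  exact ⟨WienerChaos.ae_integrable_contractionIntegrand hα hL, hc,
    WienerChaos.isMultipleIntegral_multipleIntegral hB hc⟩
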